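/- Let $d\ge 1$ and let $D\subset\mathbb R^d$ be open and bounded, $H=L^2(D)$, and let $A$ be the Laplacian on $D$ with Dirichlet boundary conditions. Let $(e_k)$ be a complete orthonormal system in $H$ of eigenfunctions, $Ae_k=-\alpha_ke_k$, with $0<\alpha_1\le\alpha_2\le\cdots$, and assume that $D$ is regular enough that $\alpha_k\asymp k^{2/d}$. For $\delta\in\mathbb R$ let $H^\delta$ be the Hilbert space of all $x=\sum_kx_ke_k$ with $|x|_{H^\delta}^2=\sum_k\alpha_k^\delta x_k^2<\infty$ (so $H^0=H$), and put $\mathcal H_\delta=H^\delta\times H^{\delta-1}$, $\mathcal H=\mathcal H_0$. Let $Q$ be a bounded linear operator on $H$ with $Qe_k=\lambda_ke_k$ and $\frac1c\alpha_k^{-\beta}\le\lambda_k\le c\,\alpha_k^{-\beta}$ for all $k$, for some $c>0$ and $\beta>(d-2)/4$. Let $B:H\to H$ satisfy $B(0)=0$ and, for every $\delta\in[0,1+2\beta]$, let $B$ map $H^\delta$ into itself and be Lipschitz continuous there with Lipschitz constant $\gamma_\delta<\alpha_1$. For $\mu>0$ let $S_\mu(t)$ be the semigroup on $\mathcal H$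 generated by $A_\mu(u,v)=(v,\frac1\mu Au-\frac1\mu v)$, and let $B_\mu(u,v)=\frac1\mu(0,B(u))$, $Q_\mu f=\frac1\mu(0,Qf)$. For $T>0$ and $z\in C([0,T];\mathcal H)$ let $I^\mu_{0,T}(z)=\frac12\inf|\psi|^2_{L^2((0,T);H)}$, the infimum being taken over all $\psi\in L^2((0,T);H)$ such that $$z(t)=S_\mu(t)z(0)+\int_0^tS_\mu(t-s)B_\mu(z(s))\,ds+\int_0^tS_\mu(t-s)Q_\mu\psi(s)\,ds,\qquad 0\le t\le T,$$ with $\inf\emptyset=+\infty$. Define the quasi-potentials $$V^\mu(x,y)=\inf\{I^\mu_{0,T}(z):\ T>0,\ z\in C([0,T];\mathcal H),\ z(0)=0,\ z(T)=(x,y)\},\quad (x,y)\in\mathcal H,$$ $$V_\mu(x)=\inf_{y\in H^{-1}}V^\mu(x,y),\quad x\in H.$$ Then for each $\mu>0$: for $(x,y)\in\mathcal H$ one has $V^\mu(x,y)<\infty$ if and only if $(x,y)\in\mathcal H_{1+2\beta}$; for $x\in H$ one has $V_\mu(x)<\infty$ if and only if $x\in H^{1+2\beta}$; and the maps $V^\mu:\mathcal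 H_{1+2\beta}\to[0,\infty)$ and $V_\mu:H^{1+2\beta}\to[0,\infty)$ are continuous for the topologies of $\mathcal H_{1+2\beta}$ and $H^{1+2\beta}$. Moreover, if $(x_n,y_n)\to(x,y)$ in $\mathcal H_{1+2\beta}$, then $$\lim_{n\to\infty}\ \sup_{0<\mu<1}|V^\mu(x,y)-V^\mu(x_n,y_n)|=0,$$ and if $x_n\to x$ in $H^{1+2\beta}$, then $$\lim_{n\to\infty}\ \sup_{0<\mu<1}|V_\mu(x)-V_\mu(x_n)|=0.$$ -/

import Mathlib

open Set Filter Topology MeasureTheory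
open scoped ENNReal Gradient ContDiff lp

noncomputable section

/-- The Hilbert space `H = L²(D)` for `D ⊆ ℝ^d`. -/
abbrev L2 {d : ℕ} (D : Set (EuclideanSpace ℝ (Fin d))) : Type :=
  Lp ℝ 2 (volume.restrict D)

/-- Test functions: smooth functions with compact support contained in `D`. -/
def IsTestFunction {d : ℕ} (D : Set (EuclideanSpace ℝ (Fin d)))
    (φ : EuclideanSpace ℝ (Fin d) → ℝ) : Prop :=
  ContDiff ℝ ∞ φ ∧ HasCompactSupport φ ∧ tsupport φ ⊆ D

/-- `u` belongs to `H¹₀(D)` (the closure of the test functions in `H¹`) and has weak gradient `g`. -/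
def HasH10Gradient {d : ℕ} (D : Set (EuclideanSpace ℝ (Fin d))) (u : L2 D)
    (g : EuclideanSpace ℝ (Fin d) → EuclideanSpace ℝ (Fin d)) : Prop :=
  MemLp g 2 (volume.restrict D) ∧
    ∃ φ : ℕ → EuclideanSpace ℝ (Fin d) → ℝ, (∀ n, IsTestFunction D (φ n)) ∧
      Tendsto (fun n => eLpNorm (fun x => φ n x - u x) 2 (volume.restrict D)) atTop (𝓝 0) ∧
      Tendsto (fun n => eLpNorm (fun x => ∇ (φ n) x - g x) 2 (volume.restrict D)) atTop (𝓝 0)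

/-- The graph of the Dirichlet Laplacian `A` in `L²(D)`: `u` is in the domain of `A` and
`A u = w`, that is, `u ∈ H¹₀(D)` and `∫ ∇u · ∇φ = - ∫ w φ` for all test functions `φ`. -/
def IsDirichletLaplacian {d : ℕ} (D : Set (EuclideanSpace ℝ (Fin d))) (u w : L2 D) : Prop :=
  ∃ g, HasH10Gradient D u g ∧ ∀ φ, IsTestFunction D φ →
    ∫ x in D, inner ℝ (g x) (∇ φ x) = - ∫ x in D, w x * φ x

/-- A complete orthonormal system of eigenfunctions of the Dirichlet Laplacian,
`A e_k = - α_k e_k`, enumerated (from `k = 0`) so that `0 < α_0 ≤ α_1 ≤ ⋯`. -/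
structure DirichletSpectrum {d : ℕ} (D : Set (EuclideanSpace ℝ (Fin d))) where
  e : HilbertBasis ℕ ℝ (L2 D)
  α : ℕ → ℝ
  eigen : ∀ k, IsDirichletLaplacian D (e k) (-(α k) • e k)
  pos : ∀ k, 0 < α k
  mono : Monotone α

namespace DirichletSpectrum

variable {d : ℕ} {D : Set (EuclideanSpace ℝ (Fin d))} (S : DirichletSpectrum D)

/-- The sequences of Fourier coefficients of elements of `H^δ`: `∑ α_k^δ x_k² < ∞`. -/
def hsSubmodule (δ : ℝ) : Submodule ℝ (ℕ → ℝ) where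
  carrier := {x | Summable fun k => S.α k ^ δ * x k ^ 2}
  zero_mem' := by simp [summable_zero]
  add_mem' := by
    intro a b ha hb
    refine Summable.of_nonneg_of_le (fun k => ?_) (fun k => ?_)
      ((ha.mul_left 2).add (hb.mul_left 2))
    · have := Real.rpow_nonneg (S.pos k).le δ
      positivity
    · have := Real.rpow_nonneg (S.pos k).le δ
      simp only [Pi.add_apply]
      nlinarith [mul_nonneg this (sq_nonneg (a k - b k))]
  smul_mem' := by
    intro c x hx
    refine (hx.mul_left (c ^ 2)).congr (fun k => ?_)
    simp only [Pi.smul_apply, smul_eq_mul]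
    ring

/-- The scale of Hilbert spaces `H^δ`, `δ ∈ ℝ`, associated with `-A`; an element is represented by
the sequence of its Fourier coefficients with respect to the eigenfunctions. -/
def Hs (δ : ℝ) : Type := S.hsSubmodule δ

instance (δ : ℝ) : AddCommGroup (S.Hs δ) := inferInstanceAs (AddCommGroup (S.hsSubmodule δ))
instance (δ : ℝ) : Module ℝ (S.Hs δ) := inferInstanceAs (Module ℝ (S.hsSubmodule δ))

/-- The linear bijection `x ↦ (α_k^{δ/2} x_k)_k` from `H^δ` onto `ℓ²`. -/
def hsLinearEquiv (δ : ℝ) : S.Hs δ ≃ₗ[ℝ] ℓ²(ℕ, ℝ) where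
  toFun x := ⟨fun k => S.α k ^ (δ / 2) * x.1 k, by
    refine memℓp_gen ?_
    refine x.2.congr (fun k => ?_)
    have h : S.α k ^ δ = (S.α k ^ (δ / 2)) ^ 2 := by
      rw [← Real.rpow_natCast, ← Real.rpow_mul (S.pos k).le]; norm_num
    simp [mul_pow, h]⟩
  invFun y := ⟨fun k => S.α k ^ (-(δ / 2)) * y k, by
    have hy := (lp.memℓp y).summable (by norm_num)
    refine hy.congr (fun k => ?_)
    have h : S.α k ^ δ * (S.α k ^ (-(δ / 2))) ^ 2 = 1 := by
      rw [← Real.rpow_natCast, ← Real.rpow_mul (S.pos k).le, ← Real.rpow_add (S.pos k)]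
      norm_num
    rw [mul_pow, ← mul_assoc, h]
    simp⟩
  map_add' x y := by
    apply Subtype.ext
    funext k
    exact mul_add _ _ _
  map_smul' c x := by
    apply Subtype.ext
    funext k
    exact mul_left_comm _ _ _
  left_inv x := by
    apply Subtype.ext
    funext k
    change S.α k ^ (-(δ / 2)) * (S.α k ^ (δ / 2) * x.1 k) = x.1 k
    rw [← mul_assoc, ← Real.rpow_add (S.pos k)]
    simp
  right_inv y := by
    apply Subtype.ext
    funext k
    change S.α k ^ (δ / 2) * (S.α k ^ (-(δ / 2)) * y k) = y k
    rw [← mul_assoc, ← Real.rpow_add (S.pos k)]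
    simp

instance (δ : ℝ) : NormedAddCommGroup (S.Hs δ) :=
  NormedAddCommGroup.induced (S.Hs δ) ℓ²(ℕ, ℝ) (S.hsLinearEquiv δ) (S.hsLinearEquiv δ).injective

instance (δ : ℝ) : NormedSpace ℝ (S.Hs δ) :=
  NormedSpace.induced ℝ (S.Hs δ) ℓ²(ℕ, ℝ) (S.hsLinearEquiv δ)

/-- The map `x ↦ (α_k^{δ/2} x_k)_k` is isometric. -/
def hsEquiv (δ : ℝ) : S.Hs δ ≃ₗᵢ[ℝ] ℓ²(ℕ, ℝ) where
  toLinearEquiv := S.hsLinearEquiv δ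
  norm_map' _ := rfl

instance (δ : ℝ) : CompleteSpace (S.Hs δ) :=
  (S.hsEquiv δ).toIsometryEquiv.completeSpace

/-- `|x|_{H^δ}² = ∑ α_k^δ x_k²` for a sequence of Fourier coefficients. -/
def hsNorm (δ : ℝ) (x : ℕ → ℝ) : ℝ := √(∑' k, S.α k ^ δ * x k ^ 2)

theorem norm_eq_hsNorm (δ : ℝ) (x : S.Hs δ) : ‖x‖ = S.hsNorm δ x.1 := by
  have h1 : ‖x‖ ^ 2 = ∑' k, S.α k ^ δ * x.1 k ^ 2 := by
    have h2 : ‖x‖ = ‖S.hsEquiv δ x‖ := rfl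
    have h3 := lp.norm_rpow_eq_tsum (p := 2) (by norm_num) (S.hsEquiv δ x)
    simp only [ENNReal.toReal_ofNat, Real.rpow_ofNat] at h3
    rw [h2, h3]
    refine tsum_congr (fun k => ?_)
    change ‖S.α k ^ (δ / 2) * x.1 k‖ ^ 2 = _
    have h : S.α k ^ δ = (S.α k ^ (δ / 2)) ^ 2 := by
      rw [← Real.rpow_natCast, ← Real.rpow_mul (S.pos k).le]; norm_num
    rw [Real.norm_eq_abs, sq_abs, mul_pow, h]
  rw [hsNorm, ← h1, Real.sqrt_sq (norm_nonneg _)]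

/-- The Fourier coefficients `⟨x, e_k⟩` of `x ∈ L²(D)`. -/
def coeff (x : L2 D) : ℕ → ℝ := fun k => inner ℝ (S.e k) x

/-- The identification of `H = L²(D)` with `H^0` through Fourier coefficients. -/
def l2Equiv : L2 D ≃ₗᵢ[ℝ] S.Hs 0 := S.e.repr.trans (S.hsEquiv 0).symm

theorem l2Equiv_apply (x : L2 D) : (S.l2Equiv x).1 = S.coeff x := by
  funext k
  change S.α k ^ (-((0 : ℝ) / 2)) * S.e.repr x k = _
  simp [coeff, HilbertBasis.repr_apply_apply]

/-- The inclusion `H^δ ⊆ H^{δ'}` for `δ' ≤ δ`. -/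
def hsIncl {δ δ' : ℝ} (h : δ' ≤ δ) (x : S.Hs δ) : S.Hs δ' :=
  ⟨x.1, by
    refine Summable.of_nonneg_of_le (fun k => ?_) (fun k => ?_)
      ((x.2 : Summable fun k => S.α k ^ δ * x.1 k ^ 2).mul_left (S.α 0 ^ (δ' - δ)))
    · have := Real.rpow_nonneg (S.pos k).le δ'
      positivity
    · have h0 : S.α k ^ δ' = S.α k ^ (δ' - δ) * S.α k ^ δ := by
        rw [← Real.rpow_add (S.pos k)]; ring_nf
      have h1 : S.α k ^ (δ' - δ) ≤ S.α 0 ^ (δ' - δ) :=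
        Real.rpow_le_rpow_of_nonpos (S.pos 0) (S.mono (Nat.zero_le k)) (by linarith)
      have h2 := Real.rpow_nonneg (S.pos k).le δ
      rw [h0, mul_assoc]
      exact mul_le_mul_of_nonneg_right h1 (by positivity)⟩

/-- The phase spaces `𝓗_δ = H^δ × H^{δ-1}`. The product carries the maximum norm, which is
equivalent to the Hilbert norm; only the topology of `𝓗_δ` is used. -/
abbrev Phase (δ : ℝ) : Type := S.Hs δ × S.Hs (δ - 1)

/-- The inclusion `𝓗_δ ⊆ 𝓗_{δ'}` for `δ' ≤ δ`. -/
def phaseIncl {δ δ' : ℝ} (h : δ' ≤ δ) (z : S.Phase δ) : S.Phase δ' :=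
  (S.hsIncl h z.1, S.hsIncl (sub_le_sub_right h 1) z.2)

/-- The action of `A_μ (u, v) = (v, μ⁻¹ A u - μ⁻¹ v)` on the `k`-th Fourier coefficients. -/
def waveMatrix (μ : ℝ) (k : ℕ) : Matrix (Fin 2) (Fin 2) ℝ :=
  !![0, 1; -(S.α k / μ), -(1 / μ)]

/-- The `k`-th Fourier coefficients of `e^{t A_μ} (u, v)`. -/
def waveMode (μ t : ℝ) (k : ℕ) (w : Fin 2 → ℝ) : Fin 2 → ℝ :=
  (NormedSpace.exp (t • S.waveMatrix μ k)).mulVec w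

theorem waveMode_hasDerivAt (μ t : ℝ) (k : ℕ) (w : Fin 2 → ℝ) :
    HasDerivAt (fun s => S.waveMode μ s k w) ((S.waveMatrix μ k).mulVec (S.waveMode μ t k w)) t := by
  let _ : NormedRing (Matrix (Fin 2) (Fin 2) ℝ) := Matrix.linftyOpNormedRing
  let _ : NormedAlgebra ℝ (Matrix (Fin 2) (Fin 2) ℝ) := Matrix.linftyOpNormedAlgebra
  have h := hasDerivAt_exp_smul_const' (𝕂 := ℝ) (S.waveMatrix μ k) t
  let L : Matrix (Fin 2) (Fin 2) ℝ →ₗ[ℝ] (Fin 2 → ℝ) :=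
    { toFun := fun M => M.mulVec w
      map_add' := fun M N => Matrix.add_mulVec M N w
      map_smul' := fun c M => Matrix.smul_mulVec c M w }
  have h2 := (LinearMap.toContinuousLinearMap L).hasFDerivAt.comp_hasDerivAt t h
  have h3 : (LinearMap.toContinuousLinearMap L)
      (S.waveMatrix μ k * NormedSpace.exp (t • S.waveMatrix μ k)) =
      (S.waveMatrix μ k).mulVec (S.waveMode μ t k w) := by
    change (S.waveMatrix μ k * NormedSpace.exp (t • S.waveMatrix μ k)).mulVec w = _
    rw [waveMode, Matrix.mulVec_mulVec]
  exact h2.congr_deriv h3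

theorem waveMode_zero (μ : ℝ) (k : ℕ) (w : Fin 2 → ℝ) : S.waveMode μ 0 k w = w := by
  simp [waveMode]

/-- Energy bound for a single mode. -/
theorem waveMode_energy_le {μ : ℝ} (hμ : 0 < μ) (t : ℝ) (k : ℕ) (w : Fin 2 → ℝ) :
    S.α k * S.waveMode μ t k w 0 ^ 2 + μ * S.waveMode μ t k w 1 ^ 2 ≤
      (1 + Real.exp (-(2 / μ * t))) * (S.α k * w 0 ^ 2 + μ * w 1 ^ 2) := by
  set c := fun s => S.waveMode μ s k w with hc
  have hα := S.pos k
  have hd0 : ∀ s, HasDerivAt (fun s => c s 0) (c s 1) s := by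
    intro s
    have h := hasDerivAt_pi.1 (S.waveMode_hasDerivAt μ s k w) 0
    simpa [waveMatrix, Matrix.mulVec, dotProduct, Fin.sum_univ_two, hc] using h
  have hd1 : ∀ s, HasDerivAt (fun s => c s 1) (-(S.α k / μ) * c s 0 + -(1 / μ) * c s 1) s := by
    intro s
    have h := hasDerivAt_pi.1 (S.waveMode_hasDerivAt μ s k w) 1
    simpa [waveMatrix, Matrix.mulVec, dotProduct, Fin.sum_univ_two, hc] using h
  set E := fun s => S.α k * c s 0 ^ 2 + μ * c s 1 ^ 2 with hE
  have hdE : ∀ s, HasDerivAt E (-2 * c s 1 ^ 2) s := by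
    intro s
    have h := (((hd0 s).pow 2).const_mul (S.α k)).add (((hd1 s).pow 2).const_mul μ)
    refine h.congr_deriv ?_
    simp
    field_simp
    ring
  have hE0 : E 0 = S.α k * w 0 ^ 2 + μ * w 1 ^ 2 := by
    simp [hE, hc, waveMode_zero]
  have hnn : ∀ s, 0 ≤ E s := fun s => by simp only [hE]; positivity
  have hanti : Antitone E := antitone_of_hasDerivAt_nonpos hdE (fun s => by
    simp only [Pi.zero_apply]; nlinarith [sq_nonneg (c s 1)])
  have hmono : Monotone (fun s => Real.exp (2 / μ * s) * E s) := by
    refine monotone_of_hasDerivAt_nonneg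
      (f' := fun s => Real.exp (2 / μ * s) * (2 / μ) * E s
        + Real.exp (2 / μ * s) * (-2 * c s 1 ^ 2)) (fun s => ?_) (fun s => ?_)
    · have h1 : HasDerivAt (fun s => Real.exp (2 / μ * s)) (Real.exp (2 / μ * s) * (2 / μ)) s := by
        have := ((hasDerivAt_id s).const_mul (2 / μ)).exp
        simpa using this
      exact h1.mul (hdE s)
    · have h2 : 2 / μ * E s + (-2 * c s 1 ^ 2) = 2 / μ * (S.α k * c s 0 ^ 2) := by
        simp only [hE]; field_simp; ring
      have h3 : Real.exp (2 / μ * s) * (2 / μ) * E s + Real.exp (2 / μ * s) * (-2 * c s 1 ^ 2)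
          = Real.exp (2 / μ * s) * (2 / μ * (S.α k * c s 0 ^ 2)) := by
        rw [← h2]; ring
      simp only [Pi.zero_apply]
      rw [h3]
      positivity
  change E t ≤ _
  rw [← hE0]
  rcases le_total 0 t with ht | ht
  · have h1 := hanti ht
    have h2 := mul_nonneg (Real.exp_pos (-(2 / μ * t))).le (hnn 0)
    linarith
  · have h1 : Real.exp (2 / μ * t) * E t ≤ E 0 := by simpa using hmono ht
    have h2 : E t = Real.exp (-(2 / μ * t)) * (Real.exp (2 / μ * t) * E t) := by
      rw [← mul_assoc, ← Real.exp_add]; simp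
    have h3 := mul_le_mul_of_nonneg_left h1 (Real.exp_pos (-(2 / μ * t))).le
    rw [← h2] at h3
    linarith [hnn 0]

theorem waveMode_summable {μ : ℝ} (hμ : 0 < μ) (δ t : ℝ) (z : S.Phase δ) :
    Summable fun k => S.α k ^ (δ - 1) *
      (S.α k * S.waveMode μ t k ![z.1.1 k, z.2.1 k] 0 ^ 2 +
        μ * S.waveMode μ t k ![z.1.1 k, z.2.1 k] 1 ^ 2) := by
  have hz1 : Summable fun k => S.α k ^ δ * z.1.1 k ^ 2 := z.1.2
  have hz2 : Summable fun k => S.α k ^ (δ - 1) * z.2.1 k ^ 2 := z.2.2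
  refine Summable.of_nonneg_of_le (fun k => ?_) (fun k => ?_)
    ((hz1.add (hz2.mul_left μ)).mul_left (1 + Real.exp (-(2 / μ * t))))
  · have h1 := Real.rpow_nonneg (S.pos k).le (δ - 1)
    have h2 := S.pos k
    positivity
  · have h1 := Real.rpow_nonneg (S.pos k).le (δ - 1)
    have h2 := mul_le_mul_of_nonneg_left (S.waveMode_energy_le hμ t k ![z.1.1 k, z.2.1 k]) h1
    have h3 : S.α k ^ δ = S.α k ^ (δ - 1) * S.α k := by
      rw [← Real.rpow_add_one (S.pos k).ne']; ring_nf
    refine h2.trans (le_of_eq ?_)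
    simp only [Matrix.cons_val_zero, Matrix.cons_val_one]
    rw [h3]
    ring

/-- The group `S_μ(t) = e^{t A_μ}` on `𝓗_δ` generated by `A_μ (u, v) = (v, μ⁻¹ A u - μ⁻¹ v)`,
in Fourier coefficients. -/
def waveSemigroup {μ : ℝ} (hμ : 0 < μ) (δ t : ℝ) (z : S.Phase δ) : S.Phase δ :=
  (⟨fun k => S.waveMode μ t k ![z.1.1 k, z.2.1 k] 0, by
      refine Summable.of_nonneg_of_le (fun k => ?_) (fun k => ?_) (S.waveMode_summable hμ δ t z)
      · have h1 := Real.rpow_nonneg (S.pos k).le δ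
        positivity
      · have h1 := Real.rpow_nonneg (S.pos k).le (δ - 1)
        have h3 : S.α k ^ δ = S.α k ^ (δ - 1) * S.α k := by
          rw [← Real.rpow_add_one (S.pos k).ne']; ring_nf
        rw [h3, mul_assoc]
        refine mul_le_mul_of_nonneg_left ?_ h1
        exact le_add_of_nonneg_right (by positivity)⟩,
   ⟨fun k => S.waveMode μ t k ![z.1.1 k, z.2.1 k] 1, by
      refine Summable.of_nonneg_of_le (fun k => ?_) (fun k => ?_)
        ((S.waveMode_summable hμ δ t z).mul_left μ⁻¹)
      · have h1 := Real.rpow_nonneg (S.pos k).le (δ - 1)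
        positivity
      · have h1 := Real.rpow_nonneg (S.pos k).le (δ - 1)
        have h2 := S.pos k
        rw [← mul_assoc, mul_comm μ⁻¹, mul_assoc]
        refine mul_le_mul_of_nonneg_left ?_ h1
        rw [mul_add, inv_mul_cancel_left₀ hμ.ne']
        exact le_add_of_nonneg_left (by positivity)⟩)

/-- The element `μ⁻¹ (0, f)` of `𝓗 = 𝓗_0`, for `f ∈ L²(D) ⊆ H^{-1}`. -/
def force (μ : ℝ) (f : L2 D) : S.Phase 0 :=
  (0, μ⁻¹ • S.hsIncl (by norm_num) (S.l2Equiv f))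

/-- `z ∈ C([t₁, t₂]; 𝓗)` is a mild solution of the controlled equation
`z' = A_μ z + B_μ(z) + Q_μ ψ`, where `B_μ(u, v) = μ⁻¹ (0, B(u))` and `Q_μ f = μ⁻¹ (0, Q f)`. -/
def IsMildSolution (Q : L2 D →L[ℝ] L2 D) (B : L2 D → L2 D) {μ : ℝ} (hμ : 0 < μ) (t₁ t₂ : ℝ)
    (ψ : ℝ → L2 D) (z : ℝ → S.Phase 0) : Prop :=
  ContinuousOn z (Icc t₁ t₂) ∧ ∀ t ∈ Icc t₁ t₂,
    z t = S.waveSemigroup hμ 0 (t - t₁) (z t₁)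
      + (∫ s in t₁..t, S.waveSemigroup hμ 0 (t - s) (S.force μ (B (S.l2Equiv.symm (z s).1))))
      + ∫ s in t₁..t, S.waveSemigroup hμ 0 (t - s) (S.force μ (Q (ψ s)))

/-- The action functional `I^μ_{t₁,t₂}(z) = ½ inf { |ψ|²_{L²((t₁,t₂);H)} : z = z^μ_ψ }`. -/
def action (Q : L2 D →L[ℝ] L2 D) (B : L2 D → L2 D) {μ : ℝ} (hμ : 0 < μ) (t₁ t₂ : ℝ)
    (z : ℝ → S.Phase 0) : ℝ≥0∞ :=
  ⨅ (ψ : ℝ → L2 D) (_ : MemLp ψ 2 (volume.restrict (Ioo t₁ t₂)))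
    (_ : S.IsMildSolution Q B hμ t₁ t₂ ψ z), (∫⁻ t in Ioo t₁ t₂, ‖ψ t‖ₑ ^ 2) / 2

/-- The quasi-potential `V^μ : 𝓗 → [0, ∞]`. -/
def quasipotential (Q : L2 D →L[ℝ] L2 D) (B : L2 D → L2 D) {μ : ℝ} (hμ : 0 < μ)
    (p : S.Phase 0) : ℝ≥0∞ :=
  ⨅ (T : ℝ) (_ : 0 < T) (z : ℝ → S.Phase 0) (_ : z 0 = 0) (_ : z T = p), S.action Q B hμ 0 T z

/-- The quasi-potential `V_μ(x) = inf_{y ∈ H^{-1}} V^μ(x, y)`, `V_μ : H → [0, ∞]`. -/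
def positionQuasipotential (Q : L2 D →L[ℝ] L2 D) (B : L2 D → L2 D) {μ : ℝ} (hμ : 0 < μ)
    (x : S.Hs 0) : ℝ≥0∞ :=
  ⨅ y : S.Hs (0 - 1), S.quasipotential Q B hμ (x, y)

/-- `Q` is diagonal with respect to the eigenfunctions, with eigenvalues comparable to
`α_k^{-β}`. -/
def IsDiagonalOfOrder (Q : L2 D →L[ℝ] L2 D) (β : ℝ) : Prop :=
  ∃ lam : ℕ → ℝ, (∀ k, Q (S.e k) = lam k • S.e k) ∧
    ∃ c > 0, ∀ k, c⁻¹ * S.α k ^ (-β) ≤ lam k ∧ lam k ≤ c * S.α k ^ (-β)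

/-- `B` maps `H^δ` into itself and is Lipschitz there with a constant smaller than the first
eigenvalue. -/
def IsSmallLipschitz (B : L2 D → L2 D) (δ : ℝ) : Prop :=
  (∀ x, S.coeff x ∈ S.hsSubmodule δ → S.coeff (B x) ∈ S.hsSubmodule δ) ∧
    ∃ γ < S.α 0, ∀ x y, S.coeff x ∈ S.hsSubmodule δ → S.coeff y ∈ S.hsSubmodule δ →
      S.hsNorm δ (S.coeff (B x - B y)) ≤ γ * S.hsNorm δ (S.coeff (x - y))

end DirichletSpectrum

theorem one_add_two_mul_nonneg_of_lt {d : ℕ} {β : ℝ} (hd : 1 ≤ d) (hβ : ((d : ℝ) - 2) / 4 < β) :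
    0 ≤ 1 + 2 * β := by
  have : (1 : ℝ) ≤ d := by exact_mod_cast hd
  linarith

end

noncomputable section

namespace DirichletSpectrum

variable {d : ℕ} {D : Set (EuclideanSpace ℝ (Fin d))} (S : DirichletSpectrum D)

/-! ### The flow on a single Fourier mode -/

/-! The quantity with good behaviour is `controlSize V = √(2V)`, the least `L²` size of a control
reaching a given point from rest. The core of the proof is that it is Lipschitz along `𝓗_{1+2β}`,
with constant `M (1 + μ)²` and `M` independent of `μ`. Since it vanishes at the origin, it is finite
there and bounded linearly by the norm; squaring gives local Lipschitz bounds for `V^μ`, uniform for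
`0 < μ < 1`. Perturbing by `(r, 0)` and minimising over the velocity transfers all of this to `V_μ`.

The Lipschitz bound comes from `exists_perturbation`. To a path `z` with control `ψ` one adds an
explicit path `w` that goes from rest to `r` during the last unit of time. No equation has to be
solved for `z + w`: as `Q` is diagonal with nonzero entries, the extra control `η` is read off from
`Q η = (forcing of w) - (B(z + w) - B(z))`. Its `L²` size is that of the right side in `H^{2β}`, and
the Lipschitz property of `B` in `H^{1+2β}` bounds the correction by `w` itself. A path that may be
shorter than one is first delayed by a unit of rest, at no cost.

The path `w` is a free damped wave run backwards and multiplied by a smooth step. Reversal changes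
the sign of the damping, so the forcing is twice the velocity plus cutoff terms. Dissipation makes
the squared velocity integrable in time, with integral at most the energy `α_k x_k² + μ y_k²`. No
inverse power of `μ` appears, whence the uniformity.

Conversely, `IsMildSolution.mem_hsSubmodule` shows that every controlled path lies in `𝓗_{1+2β}`:
the flow gains one order over its forcing, `Q ψ` lies in `H^{2β}`, and a bootstrap deals with `B`.
Everything is computed mode by mode, where the flow is a `2 × 2` matrix exponential. -/

theorem waveMode_add (μ t : ℝ) (k : ℕ) (v w : Fin 2 → ℝ) :
    S.waveMode μ t k (v + w) = S.waveMode μ t k v + S.waveMode μ t k w :=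
  Matrix.mulVec_add _ _ _

theorem waveMode_smul (μ t : ℝ) (k : ℕ) (c : ℝ) (w : Fin 2 → ℝ) :
    S.waveMode μ t k (c • w) = c • S.waveMode μ t k w :=
  Matrix.mulVec_smul _ _ _

theorem waveMode_cons (μ t : ℝ) (k : ℕ) (a b : ℝ) (i : Fin 2) :
    S.waveMode μ t k ![a, b] i =
      a * S.waveMode μ t k ![1, 0] i + b * S.waveMode μ t k ![0, 1] i := by
  have h : (![a, b] : Fin 2 → ℝ) = a • ![1, 0] + b • ![0, 1] := by
    funext j; fin_cases j <;> simp
  rw [h, waveMode_add, waveMode_smul, waveMode_smul]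
  simp

/-- The exponential has a derivative with the generator written on either side, and derivatives are
unique. -/
theorem waveMode_mulVec_waveMatrix (μ t : ℝ) (k : ℕ) (w : Fin 2 → ℝ) :
    S.waveMode μ t k ((S.waveMatrix μ k).mulVec w) =
      (S.waveMatrix μ k).mulVec (S.waveMode μ t k w) := by
  let _ : NormedRing (Matrix (Fin 2) (Fin 2) ℝ) := Matrix.linftyOpNormedRing
  let _ : NormedAlgebra ℝ (Matrix (Fin 2) (Fin 2) ℝ) := Matrix.linftyOpNormedAlgebra
  have h := (hasDerivAt_exp_smul_const (𝕂 := ℝ) (S.waveMatrix μ k) t).unique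
    (hasDerivAt_exp_smul_const' (𝕂 := ℝ) (S.waveMatrix μ k) t)
  rw [waveMode, waveMode, Matrix.mulVec_mulVec, Matrix.mulVec_mulVec]
  exact congrArg (fun M : Matrix (Fin 2) (Fin 2) ℝ => M.mulVec w) h

theorem waveMode_hasDerivAt_fst (μ t : ℝ) (k : ℕ) (w : Fin 2 → ℝ) :
    HasDerivAt (fun s => S.waveMode μ s k w 0) (S.waveMode μ t k w 1) t := by
  have h := hasDerivAt_pi.1 (S.waveMode_hasDerivAt μ t k w) 0
  simpa [waveMatrix, Matrix.mulVec, dotProduct, Fin.sum_univ_two] using h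

theorem waveMode_hasDerivAt_snd (μ t : ℝ) (k : ℕ) (w : Fin 2 → ℝ) :
    HasDerivAt (fun s => S.waveMode μ s k w 1)
      (-(S.α k / μ) * S.waveMode μ t k w 0 + -(1 / μ) * S.waveMode μ t k w 1) t := by
  have h := hasDerivAt_pi.1 (S.waveMode_hasDerivAt μ t k w) 1
  simpa [waveMatrix, Matrix.mulVec, dotProduct, Fin.sum_univ_two] using h

theorem continuous_waveMode (μ : ℝ) (k : ℕ) (w : Fin 2 → ℝ) (i : Fin 2) :
    Continuous fun t => S.waveMode μ t k w i :=
  continuous_iff_continuousAt.2 fun t =>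
    (hasDerivAt_pi.1 (S.waveMode_hasDerivAt μ t k w) i).continuousAt

/-- The generator is moved onto the datum, the form needed to differentiate the kernel of Duhamel's
formula in `s`. -/
theorem waveMode_hasDerivAt_cons (μ t : ℝ) (k : ℕ) (a b : ℝ) (i : Fin 2) :
    HasDerivAt (fun s => S.waveMode μ s k ![a, b] i)
      (S.waveMode μ t k ![b, -(S.α k / μ) * a + -(1 / μ) * b] i) t := by
  have h := hasDerivAt_pi.1 (S.waveMode_hasDerivAt μ t k ![a, b]) i
  rw [← waveMode_mulVec_waveMatrix] at h
  have h2 : (S.waveMatrix μ k).mulVec ![a, b] =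
      ![b, -(S.α k / μ) * a + -(1 / μ) * b] := by
    funext j
    fin_cases j <;> simp [waveMatrix, Matrix.mulVec, dotProduct, Fin.sum_univ_two]
  rwa [h2] at h

/-- Duhamel's formula for a single mode started at rest. -/
theorem waveMode_duhamel (μ : ℝ) (k : ℕ) {w₀ w₁ g : ℝ → ℝ} (hg : Continuous g)
    (h₀ : ∀ s, HasDerivAt w₀ (w₁ s) s)
    (h₁ : ∀ s, HasDerivAt w₁ (-(S.α k / μ) * w₀ s + -(1 / μ) * w₁ s + μ⁻¹ * g s) s)
    (hw₀ : w₀ 0 = 0) (hw₁ : w₁ 0 = 0) (t : ℝ) (i : Fin 2) :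
    (![w₀ t, w₁ t] : Fin 2 → ℝ) i =
      ∫ s in (0 : ℝ)..t, S.waveMode μ (t - s) k ![0, μ⁻¹ * g s] i := by
  have hc : ∀ (a b s : ℝ), HasDerivAt (fun s => S.waveMode μ (t - s) k ![a, b] i)
      (-S.waveMode μ (t - s) k ![b, -(S.α k / μ) * a + -(1 / μ) * b] i) s := by
    intro a b s
    have h := (S.waveMode_hasDerivAt_cons μ (t - s) k a b i).scomp s
      ((hasDerivAt_id s).const_sub t)
    simpa [Function.comp_def] using h
  -- This function is `e^{(t-s)A_μ}` applied to `(w₀ s, w₁ s)`. In its derivative the generator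
  -- terms cancel and only the forcing is left, so its increment over `[0, t]` is the claim.
  have hF : ∀ s, HasDerivAt (fun s => w₀ s * S.waveMode μ (t - s) k ![1, 0] i
      + w₁ s * S.waveMode μ (t - s) k ![0, 1] i)
      (S.waveMode μ (t - s) k ![0, μ⁻¹ * g s] i) s := by
    intro s
    refine (((h₀ s).mul (hc 1 0 s)).add ((h₁ s).mul (hc 0 1 s))).congr_deriv ?_
    simp only [mul_one, mul_zero, add_zero, zero_add]
    rw [waveMode_cons _ _ _ _ 0 (-(S.α k / μ)), waveMode_cons _ _ _ _ 1 (-(1 / μ)),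
      waveMode_cons _ _ _ _ 0 (μ⁻¹ * g s)]
    ring
  have hcont : Continuous fun s => S.waveMode μ (t - s) k ![0, μ⁻¹ * g s] i := by
    have h1 : (fun s => S.waveMode μ (t - s) k ![0, μ⁻¹ * g s] i) =
        fun s => μ⁻¹ * g s * S.waveMode μ (t - s) k ![0, 1] i := by
      funext s
      rw [waveMode_cons]
      ring
    rw [h1]
    exact (continuous_const.mul hg).mul
      ((S.continuous_waveMode μ k _ i).comp (continuous_const.sub continuous_id))
  rw [intervalIntegral.integral_eq_sub_of_hasDerivAt (fun s _ => hF s)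
    (hcont.intervalIntegrable _ _), hw₀, hw₁, sub_self, waveMode_zero, waveMode_zero]
  fin_cases i <;> simp

/-- Forward in time the exponential in `waveMode_energy_le` is at most `1`; the resulting constant
depends on neither `μ` nor `k`. -/
theorem waveMode_energy_le_two_mul {μ : ℝ} (hμ : 0 < μ) {t : ℝ} (ht : 0 ≤ t) (k : ℕ)
    (w : Fin 2 → ℝ) :
    S.α k * S.waveMode μ t k w 0 ^ 2 + μ * S.waveMode μ t k w 1 ^ 2 ≤
      2 * (S.α k * w 0 ^ 2 + μ * w 1 ^ 2) := by
  refine (S.waveMode_energy_le hμ t k w).trans (mul_le_mul_of_nonneg_right ?_ ?_)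
  · have : Real.exp (-(2 / μ * t)) ≤ 1 := Real.exp_le_one_iff.2 (by
      have : 0 ≤ 2 / μ * t := by positivity
      linarith)
    linarith
  · have := (S.pos k).le
    positivity

/-- The energy of a mode dissipates through its velocity. -/
theorem integral_waveMode_snd_sq_le {μ : ℝ} (hμ : 0 < μ) (t : ℝ) (k : ℕ) (w : Fin 2 → ℝ) :
    ∫ s in (0 : ℝ)..t, S.waveMode μ s k w 1 ^ 2 ≤ S.α k * w 0 ^ 2 + μ * w 1 ^ 2 := by
  have hα := S.pos k
  have hd : ∀ s, HasDerivAt (fun s => -(1 / 2) * (S.α k * S.waveMode μ s k w 0 ^ 2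
      + μ * S.waveMode μ s k w 1 ^ 2)) (S.waveMode μ s k w 1 ^ 2) s := by
    intro s
    have h := ((((S.waveMode_hasDerivAt_fst μ s k w).pow 2).const_mul (S.α k)).add
      (((S.waveMode_hasDerivAt_snd μ s k w).pow 2).const_mul μ)).const_mul (-(1 / 2))
    refine h.congr_deriv ?_
    simp
    field_simp
    ring
  rw [intervalIntegral.integral_eq_sub_of_hasDerivAt (fun s _ => hd s)
    (((S.continuous_waveMode μ k w 1).pow 2).intervalIntegrable _ _)]
  simp only [waveMode_zero]
  have h1 : 0 ≤ S.α k * S.waveMode μ t k w 0 ^ 2 + μ * S.waveMode μ t k w 1 ^ 2 := by positivity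
  have h2 : 0 ≤ S.α k * w 0 ^ 2 + μ * w 1 ^ 2 := by positivity
  linarith

/-! ### Squared norms as extended sums over modes -/

/-- The squared `H^δ` norm of a sequence of Fourier coefficients, possibly infinite. -/
def eSq (δ : ℝ) (x : ℕ → ℝ) : ℝ≥0∞ := ∑' k, ENNReal.ofReal (S.α k ^ δ * x k ^ 2)

theorem rpow_mul_sq_nonneg (δ : ℝ) (x : ℕ → ℝ) (k : ℕ) : 0 ≤ S.α k ^ δ * x k ^ 2 :=
  mul_nonneg (Real.rpow_nonneg (S.pos k).le δ) (sq_nonneg _)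

/-- Extended sums allow norm estimates before summability is known; membership in `H^δ` is then
recovered from finiteness. -/
theorem mem_hsSubmodule_iff_eSq_ne_top {δ : ℝ} {x : ℕ → ℝ} :
    x ∈ S.hsSubmodule δ ↔ S.eSq δ x ≠ ⊤ := by
  constructor
  · intro hx
    exact Summable.tsum_ofReal_ne_top hx
  · intro hx
    have h := ENNReal.summable_toReal hx
    exact h.congr fun k => (ENNReal.toReal_ofReal (S.rpow_mul_sq_nonneg δ x k))

theorem eSq_eq_ofReal_hsNorm_sq {δ : ℝ} {x : ℕ → ℝ} (hx : x ∈ S.hsSubmodule δ) :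
    S.eSq δ x = ENNReal.ofReal (S.hsNorm δ x ^ 2) := by
  rw [hsNorm, Real.sq_sqrt (tsum_nonneg fun k => S.rpow_mul_sq_nonneg δ x k)]
  exact (ENNReal.ofReal_tsum_of_nonneg (S.rpow_mul_sq_nonneg δ x) hx).symm

theorem Hs.enorm_sq {δ : ℝ} (x : S.Hs δ) : ‖x‖ₑ ^ 2 = S.eSq δ x.1 := by
  rw [S.eSq_eq_ofReal_hsNorm_sq x.2, ← norm_eq_hsNorm, ENNReal.ofReal_pow (norm_nonneg _),
    ofReal_norm]

theorem coeff_eq_l2Equiv (f : L2 D) : S.coeff f = (S.l2Equiv f).1 := (S.l2Equiv_apply f).symm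

theorem coeff_l2Equiv_symm (u : S.Hs 0) : S.coeff (S.l2Equiv.symm u) = u.1 := by
  rw [coeff_eq_l2Equiv, LinearIsometryEquiv.apply_symm_apply]

theorem enorm_sq_eq_eSq_coeff (f : L2 D) : ‖f‖ₑ ^ 2 = S.eSq 0 (S.coeff f) := by
  rw [coeff_eq_l2Equiv, ← Hs.enorm_sq, LinearIsometryEquiv.enorm_map]

theorem coeff_mem (f : L2 D) : S.coeff f ∈ S.hsSubmodule 0 := by
  rw [coeff_eq_l2Equiv]
  exact (S.l2Equiv f).2

theorem coeff_add (f g : L2 D) : S.coeff (f + g) = S.coeff f + S.coeff g := by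
  funext k; simp [coeff, inner_add_right]

theorem coeff_sub (f g : L2 D) : S.coeff (f - g) = S.coeff f - S.coeff g := by
  funext k; simp [coeff, inner_sub_right]

theorem coeff_zero : S.coeff (0 : L2 D) = 0 := by
  funext k; simp [coeff]

theorem continuous_coeff (k : ℕ) : Continuous fun f : L2 D => S.coeff f k := by
  unfold coeff
  fun_prop

theorem eSq_le_of_le {δ δ' : ℝ} (h : δ' ≤ δ) (x : ℕ → ℝ) :
    S.eSq δ' x ≤ ENNReal.ofReal (S.α 0 ^ (δ' - δ)) * S.eSq δ x := by
  rw [eSq, eSq, ← ENNReal.tsum_mul_left]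
  refine ENNReal.tsum_le_tsum fun k => ?_
  rw [← ENNReal.ofReal_mul (Real.rpow_nonneg (S.pos 0).le _)]
  refine ENNReal.ofReal_le_ofReal ?_
  have h0 : S.α k ^ δ' = S.α k ^ (δ' - δ) * S.α k ^ δ := by
    rw [← Real.rpow_add (S.pos k)]; ring_nf
  have h1 : S.α k ^ (δ' - δ) ≤ S.α 0 ^ (δ' - δ) :=
    Real.rpow_le_rpow_of_nonpos (S.pos 0) (S.mono (Nat.zero_le k)) (by linarith)
  rw [h0, mul_assoc]
  exact mul_le_mul_of_nonneg_right h1 (S.rpow_mul_sq_nonneg δ x k)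

theorem eSq_add_le (δ : ℝ) (x y : ℕ → ℝ) :
    S.eSq δ (x + y) ≤ 2 * S.eSq δ x + 2 * S.eSq δ y := by
  rw [eSq, eSq, eSq, ← ENNReal.tsum_mul_left, ← ENNReal.tsum_mul_left, ← ENNReal.tsum_add]
  refine ENNReal.tsum_le_tsum fun k => ?_
  have hx := S.rpow_mul_sq_nonneg δ x k
  have hy := S.rpow_mul_sq_nonneg δ y k
  have h2 : (2 : ℝ≥0∞) = ENNReal.ofReal 2 := by simp
  rw [h2, ← ENNReal.ofReal_mul zero_le_two, ← ENNReal.ofReal_mul zero_le_two,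
    ← ENNReal.ofReal_add (by positivity) (by positivity)]
  refine ENNReal.ofReal_le_ofReal ?_
  have h := Real.rpow_nonneg (S.pos k).le δ
  simp only [Pi.add_apply]
  nlinarith [mul_nonneg h (sq_nonneg (x k - y k))]

/-- Lipschitz continuity of `B` in `H^δ` in terms of extended squared norms. -/
theorem IsSmallLipschitz.exists_eSq_le {B : L2 D → L2 D} {δ : ℝ} (hB : S.IsSmallLipschitz B δ) :
    ∃ C : ℝ, 0 ≤ C ∧ ∀ f g, S.coeff f ∈ S.hsSubmodule δ → S.coeff g ∈ S.hsSubmodule δ →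
      S.eSq δ (S.coeff (B f - B g)) ≤ ENNReal.ofReal C * S.eSq δ (S.coeff (f - g)) := by
  obtain ⟨hmaps, γ, -, hγ⟩ := hB
  refine ⟨γ ^ 2, sq_nonneg γ, fun f g hf hg => ?_⟩
  have h1 : S.coeff (B f - B g) ∈ S.hsSubmodule δ := by
    rw [coeff_sub]
    exact Submodule.sub_mem _ (hmaps f hf) (hmaps g hg)
  have h2 : S.coeff (f - g) ∈ S.hsSubmodule δ := by
    rw [coeff_sub]
    exact Submodule.sub_mem _ hf hg
  rw [S.eSq_eq_ofReal_hsNorm_sq h1, S.eSq_eq_ofReal_hsNorm_sq h2,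
    ← ENNReal.ofReal_mul (sq_nonneg γ), ← mul_pow]
  exact ENNReal.ofReal_le_ofReal (pow_le_pow_left₀ (Real.sqrt_nonneg _) (hγ f g hf hg) 2)

theorem IsSmallLipschitz.continuous {B : L2 D → L2 D} (hB : S.IsSmallLipschitz B 0) :
    Continuous B := by
  obtain ⟨-, γ, -, hγ⟩ := hB
  have hn : ∀ f, S.hsNorm 0 (S.coeff f) = ‖f‖ := fun f => by
    rw [coeff_eq_l2Equiv, ← norm_eq_hsNorm, LinearIsometryEquiv.norm_map]
  refine (LipschitzWith.of_dist_le_mul (K := γ.toNNReal) fun f g => ?_).continuous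
  rw [dist_eq_norm, dist_eq_norm, ← hn, ← hn]
  refine (hγ f g (S.coeff_mem f) (S.coeff_mem g)).trans ?_
  exact mul_le_mul_of_nonneg_right (Real.le_coe_toNNReal γ) (Real.sqrt_nonneg _)

theorem coeff_apply_of_diagonal {Q : L2 D →L[ℝ] L2 D} {lam : ℕ → ℝ}
    (hQ : ∀ k, Q (S.e k) = lam k • S.e k) (f : L2 D) (k : ℕ) :
    S.coeff (Q f) k = lam k * S.coeff f k := by
  have h1 := (S.e.hasSum_repr f).mapL Q
  have h2 := h1.mapL (innerSL ℝ (S.e k))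
  have h3 : ∀ j, (innerSL ℝ (S.e k)) (Q (S.e.repr f j • S.e j)) =
      if j = k then lam k * S.coeff f k else 0 := by
    intro j
    have ho := orthonormal_iff_ite.1 S.e.orthonormal k j
    simp only [map_smul, hQ, innerSL_apply_apply, ho, smul_eq_mul]
    split_ifs with h h' h'
    · subst h
      rw [HilbertBasis.repr_apply_apply]
      simp only [coeff]; ring
    · exact absurd h.symm h'
    · exact absurd h'.symm h
    · simp
  simp only [h3] at h2
  exact h2.unique (hasSum_ite_eq k _)

/-- The `k`-th Fourier coefficient as a continuous functional on `H^δ`. -/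
def Hs.coord (δ : ℝ) (k : ℕ) : S.Hs δ →L[ℝ] ℝ :=
  S.α k ^ (-(δ / 2)) • (lp.evalCLM ℝ (fun _ : ℕ => ℝ) 2 k).comp
    (S.hsEquiv δ).toContinuousLinearEquiv.toContinuousLinearMap

@[simp]
theorem Hs.coord_apply (δ : ℝ) (k : ℕ) (x : S.Hs δ) : Hs.coord S δ k x = x.1 k := by
  change S.α k ^ (-(δ / 2)) * (S.α k ^ (δ / 2) * x.1 k) = x.1 k
  rw [← mul_assoc, ← Real.rpow_add (S.pos k)]
  simp

/-! ### Measurability and integration through Fourier coefficients -/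

theorem hasSum_coeff (f : L2 D) : HasSum (fun k => S.coeff f k • S.e k) f := by
  simpa [coeff, HilbertBasis.repr_apply_apply] using S.e.hasSum_repr f

/-- A function is the pointwise limit of its partial Fourier sums, so scalar measurability suffices.
-/
theorem aestronglyMeasurable_of_coeff {ν : Measure ℝ} {f : ℝ → L2 D}
    (hf : ∀ k, AEStronglyMeasurable (fun s => S.coeff (f s) k) ν) :
    AEStronglyMeasurable f ν := by
  refine aestronglyMeasurable_of_tendsto_ae atTop
    (f := fun n s => ∑ k ∈ Finset.range n, S.coeff (f s) k • S.e k) (fun n => ?_)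
    (Eventually.of_forall fun s => (S.hasSum_coeff (f s)).tendsto_sum_nat)
  exact Finset.aestronglyMeasurable_fun_sum _ fun k _ => (hf k).smul_const _

/-- The isometry `x ↦ ∑ α_k^{δ/2} x_k e_k` of `H^δ` onto `L²(D)`. -/
def Hs.toL2 (δ : ℝ) : S.Hs δ ≃ₗᵢ[ℝ] L2 D := (S.hsEquiv δ).trans S.e.repr.symm

theorem Hs.coeff_toL2 (δ : ℝ) (x : S.Hs δ) (k : ℕ) :
    S.coeff (Hs.toL2 S δ x) k = S.α k ^ (δ / 2) * x.1 k := by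
  rw [coeff, ← HilbertBasis.repr_apply_apply]
  simp only [toL2, LinearIsometryEquiv.trans_apply, LinearIsometryEquiv.apply_symm_apply]
  rfl

theorem Hs.aestronglyMeasurable_of_coord {δ : ℝ} {ν : Measure ℝ} {f : ℝ → S.Hs δ}
    (hf : ∀ k, AEStronglyMeasurable (fun s => (f s).1 k) ν) :
    AEStronglyMeasurable f ν := by
  have h : AEStronglyMeasurable (fun s => Hs.toL2 S δ (f s)) ν :=
    S.aestronglyMeasurable_of_coeff fun k => by
      simpa only [Hs.coeff_toL2] using (hf k).const_mul _
  have h2 := (Hs.toL2 S δ).symm.continuous.comp_aestronglyMeasurable h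
  simpa using h2

theorem Hs.norm_le_of_eSq_le {δ δ' C : ℝ} (hC : 0 ≤ C) {x : S.Hs δ} {y : S.Hs δ'}
    (h : S.eSq δ x.1 ≤ ENNReal.ofReal C * S.eSq δ' y.1) : ‖x‖ ≤ √C * ‖y‖ := by
  rw [← Hs.enorm_sq, ← Hs.enorm_sq, ← ofReal_norm, ← ofReal_norm,
    ← ENNReal.ofReal_pow (norm_nonneg _), ← ENNReal.ofReal_pow (norm_nonneg _),
    ← ENNReal.ofReal_mul hC, ENNReal.ofReal_le_ofReal_iff (by positivity)] at h
  refine abs_le_of_sq_le_sq' ?_ (by positivity) |>.2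
  rw [mul_pow, Real.sq_sqrt hC]
  exact h

theorem Hs.norm_le_of_eSq_le_coeff {δ C : ℝ} (hC : 0 ≤ C) {x : S.Hs δ} {f : L2 D}
    (h : S.eSq δ x.1 ≤ ENNReal.ofReal C * S.eSq 0 (S.coeff f)) : ‖x‖ ≤ √C * ‖f‖ := by
  rw [coeff_eq_l2Equiv] at h
  simpa only [LinearIsometryEquiv.norm_map] using Hs.norm_le_of_eSq_le S hC h

/-- A family in `H^δ` with continuous coefficients and a common summable majorant is continuous. -/
theorem Hs.continuousOn_of_dominated {δ : ℝ} {u : ℝ → S.Hs δ} {s : Set ℝ} {b : ℕ → ℝ}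
    (hb : Summable b) (hu : ∀ k, ContinuousOn (fun t => (u t).1 k) s)
    (hle : ∀ t ∈ s, ∀ k, S.α k ^ δ * (u t).1 k ^ 2 ≤ b k) : ContinuousOn u s := by
  intro t ht
  have hnorm : ∀ x : S.Hs δ, ‖x‖ ^ 2 = ∑' k, S.α k ^ δ * x.1 k ^ 2 := fun x => by
    rw [norm_eq_hsNorm, hsNorm, Real.sq_sqrt (tsum_nonneg fun k => S.rpow_mul_sq_nonneg δ x.1 k)]
  have h1 : Tendsto (fun r => ‖u r - u t‖ ^ 2) (𝓝[s] t) (𝓝 (∑' _ : ℕ, (0 : ℝ))) := by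
    simp only [hnorm]
    -- The majorant `4 b_k` comes from `(x - y)² ≤ 2x² + 2y²`.
    refine tendsto_tsum_of_dominated_convergence (bound := fun k => 4 * b k) (hb.mul_left 4)
      (fun k => ?_) ?_
    · change Tendsto (fun r => S.α k ^ δ * ((u r).1 k - (u t).1 k) ^ 2) _ _
      have h2 : Tendsto (fun r => (u r).1 k - (u t).1 k) (𝓝[s] t) (𝓝 0) := by
        have := (hu k t ht).tendsto.sub_const ((u t).1 k)
        rwa [sub_self] at this
      have h3 := (h2.pow 2).const_mul (S.α k ^ δ)
      simpa using h3
    · filter_upwards [self_mem_nhdsWithin] with r hr k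
      rw [Real.norm_of_nonneg (S.rpow_mul_sq_nonneg δ _ k)]
      have h4 := hle r hr k
      have h5 := hle t ht k
      have h6 := Real.rpow_nonneg (S.pos k).le δ
      change S.α k ^ δ * ((u r).1 k - (u t).1 k) ^ 2 ≤ 4 * b k
      nlinarith [mul_nonneg h6 (sq_nonneg ((u r).1 k + (u t).1 k))]
  rw [tsum_zero] at h1
  have h7 : Tendsto (fun r => ‖u r - u t‖) (𝓝[s] t) (𝓝 0) := by
    have := h1.sqrt
    simpa [Real.sqrt_sq] using this
  exact tendsto_iff_norm_sub_tendsto_zero.2 h7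

/-! ### Mild solutions in the phase space, mode by mode -/

/-- The pair of `k`-th Fourier coefficients of an element of the phase space. -/
def mode {δ : ℝ} (z : S.Phase δ) (k : ℕ) : Fin 2 → ℝ := ![z.1.1 k, z.2.1 k]

variable {S} in
theorem mode_ext {δ : ℝ} {z z' : S.Phase δ} (h : ∀ k i, S.mode z k i = S.mode z' k i) :
    z = z' :=
  Prod.ext (Subtype.ext (funext fun k => h k 0)) (Subtype.ext (funext fun k => h k 1))

theorem mode_add {δ : ℝ} (z z' : S.Phase δ) (k : ℕ) (i : Fin 2) :
    S.mode (z + z') k i = S.mode z k i + S.mode z' k i := by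
  fin_cases i <;> rfl

theorem mode_zero {δ : ℝ} (k : ℕ) (i : Fin 2) : S.mode (0 : S.Phase δ) k i = 0 := by
  fin_cases i <;> rfl

theorem mode_waveSemigroup {μ : ℝ} (hμ : 0 < μ) (δ t : ℝ) (z : S.Phase δ) (k : ℕ) (i : Fin 2) :
    S.mode (S.waveSemigroup hμ δ t z) k i = S.waveMode μ t k (S.mode z k) i := by
  fin_cases i <;> rfl

theorem mode_force (μ : ℝ) (f : L2 D) (k : ℕ) :
    S.mode (S.force μ f) k = ![0, μ⁻¹ * S.coeff f k] := by
  rw [coeff_eq_l2Equiv]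
  rfl

/-- A Fourier coefficient as a continuous functional on the phase space. -/
def modeL (δ : ℝ) (k : ℕ) (i : Fin 2) : S.Phase δ →L[ℝ] ℝ :=
  if i = 0 then (Hs.coord S δ k).comp (ContinuousLinearMap.fst ℝ _ _)
  else (Hs.coord S (δ - 1) k).comp (ContinuousLinearMap.snd ℝ _ _)

theorem modeL_apply (δ : ℝ) (k : ℕ) (i : Fin 2) (z : S.Phase δ) :
    S.modeL δ k i z = S.mode z k i := by
  fin_cases i <;> simp [modeL, mode]

/-- For `t ≥ 0` each mode keeps at most twice its initial energy, which is a summable majorant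
independent of `t`. -/
theorem continuousOn_waveSemigroup {μ : ℝ} (hμ : 0 < μ) (δ : ℝ) (z : S.Phase δ) :
    ContinuousOn (fun t => S.waveSemigroup hμ δ t z) (Ici 0) := by
  have hz1 : Summable fun k => S.α k ^ δ * z.1.1 k ^ 2 := z.1.2
  have hz2 : Summable fun k => S.α k ^ (δ - 1) * z.2.1 k ^ 2 := z.2.2
  have hα : ∀ k, S.α k ^ δ = S.α k ^ (δ - 1) * S.α k := fun k => by
    rw [← Real.rpow_add_one (S.pos k).ne']; ring_nf
  have hs := (hz1.add (hz2.mul_left μ)).mul_left 2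
  have key : ∀ t ∈ Ici (0 : ℝ), ∀ k, S.α k ^ δ * S.waveMode μ t k ![z.1.1 k, z.2.1 k] 0 ^ 2 +
      μ * (S.α k ^ (δ - 1) * S.waveMode μ t k ![z.1.1 k, z.2.1 k] 1 ^ 2) ≤
      2 * (S.α k ^ δ * z.1.1 k ^ 2 + μ * (S.α k ^ (δ - 1) * z.2.1 k ^ 2)) := by
    intro t ht k
    have h := mul_le_mul_of_nonneg_left
      (S.waveMode_energy_le_two_mul hμ ht k ![z.1.1 k, z.2.1 k])
      (Real.rpow_nonneg (S.pos k).le (δ - 1))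
    simp only [Matrix.cons_val_zero, Matrix.cons_val_one] at h
    rw [hα]
    linarith
  refine ContinuousOn.prodMk ?_ ?_
  · refine Hs.continuousOn_of_dominated S hs
      (fun k => (S.continuous_waveMode μ k _ 0).continuousOn) fun t ht k => ?_
    have h1 := key t ht k
    have h2 := Real.rpow_nonneg (S.pos k).le (δ - 1)
    have h3 : 0 ≤ μ * (S.α k ^ (δ - 1) * S.waveMode μ t k ![z.1.1 k, z.2.1 k] 1 ^ 2) := by
      positivity
    refine le_trans ?_ h1
    exact le_add_of_nonneg_right h3
  · refine Hs.continuousOn_of_dominated S (hs.mul_left μ⁻¹)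
      (fun k => (S.continuous_waveMode μ k _ 1).continuousOn) fun t ht k => ?_
    have h1 := key t ht k
    have h2 := Real.rpow_nonneg (S.pos k).le δ
    rw [le_inv_mul_iff₀ hμ]
    refine le_trans ?_ h1
    exact le_add_of_nonneg_left (by positivity)

/-- The energy bound makes this uniform in `t ≥ 0`. It serves only to integrate the Duhamel kernel,
so the powers of `1/μ` are harmless. -/
theorem norm_waveSemigroup_force_le {μ : ℝ} (hμ : 0 < μ) {t : ℝ} (ht : 0 ≤ t) (f : L2 D) :
    ‖S.waveSemigroup hμ 0 t (S.force μ f)‖ ≤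
      (√(2 / (μ * S.α 0)) + √(2 / (μ ^ 2 * S.α 0))) * ‖f‖ := by
  have hα0 := S.pos 0
  have key : ∀ k, S.α k * S.mode (S.waveSemigroup hμ 0 t (S.force μ f)) k 0 ^ 2 +
      μ * S.mode (S.waveSemigroup hμ 0 t (S.force μ f)) k 1 ^ 2 ≤ 2 / μ * S.coeff f k ^ 2 := by
    intro k
    rw [mode_waveSemigroup, mode_waveSemigroup, mode_force]
    refine (S.waveMode_energy_le_two_mul hμ ht k _).trans (le_of_eq ?_)
    simp only [Matrix.cons_val_zero, Matrix.cons_val_one]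
    field_simp
    ring
  have h1 : ‖(S.waveSemigroup hμ 0 t (S.force μ f)).1‖ ≤ √(2 / (μ * S.α 0)) * ‖f‖ := by
    refine Hs.norm_le_of_eSq_le_coeff S (by positivity) ?_
    rw [eSq, eSq, ← ENNReal.tsum_mul_left]
    refine ENNReal.tsum_le_tsum fun k => ?_
    rw [← ENNReal.ofReal_mul (by positivity)]
    refine ENNReal.ofReal_le_ofReal ?_
    rw [Real.rpow_zero, one_mul, one_mul]
    have h2 := key k
    have h3 := S.mono (Nat.zero_le k)
    set x := S.mode (S.waveSemigroup hμ 0 t (S.force μ f)) k 0 with hx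
    have h4 : S.α 0 * x ^ 2 ≤ 2 / μ * S.coeff f k ^ 2 := by
      have : 0 ≤ μ * S.mode (S.waveSemigroup hμ 0 t (S.force μ f)) k 1 ^ 2 := by positivity
      nlinarith [mul_le_mul_of_nonneg_right h3 (sq_nonneg x)]
    change x ^ 2 ≤ _
    rw [show 2 / (μ * S.α 0) * S.coeff f k ^ 2 = (S.α 0)⁻¹ * (2 / μ * S.coeff f k ^ 2) by
      field_simp, le_inv_mul_iff₀ hα0]
    exact h4
  have h2 : ‖(S.waveSemigroup hμ 0 t (S.force μ f)).2‖ ≤ √(2 / (μ ^ 2 * S.α 0)) * ‖f‖ := by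
    refine Hs.norm_le_of_eSq_le_coeff S (by positivity) ?_
    rw [eSq, eSq, ← ENNReal.tsum_mul_left]
    refine ENNReal.tsum_le_tsum fun k => ?_
    rw [← ENNReal.ofReal_mul (by positivity)]
    refine ENNReal.ofReal_le_ofReal ?_
    rw [Real.rpow_zero, one_mul]
    have h2 := key k
    have h3 := S.mono (Nat.zero_le k)
    have hαk := S.pos k
    set x := S.mode (S.waveSemigroup hμ 0 t (S.force μ f)) k 1 with hx
    have h4 : μ * x ^ 2 ≤ 2 / μ * S.coeff f k ^ 2 := by
      have : 0 ≤ S.α k * S.mode (S.waveSemigroup hμ 0 t (S.force μ f)) k 0 ^ 2 := by positivity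
      linarith
    change S.α k ^ ((0 : ℝ) - 1) * x ^ 2 ≤ _
    have h5 : S.α k ^ ((0 : ℝ) - 1) ≤ (S.α 0)⁻¹ := by
      rw [zero_sub, Real.rpow_neg_one]
      exact inv_anti₀ hα0 h3
    rw [show 2 / (μ ^ 2 * S.α 0) * S.coeff f k ^ 2 =
      (S.α 0)⁻¹ * (μ⁻¹ * (2 / μ * S.coeff f k ^ 2)) by field_simp]
    refine mul_le_mul h5 ?_ (sq_nonneg _) (by positivity)
    rwa [le_inv_mul_iff₀ hμ]
  rw [add_mul]
  refine max_le (h1.trans ?_) (h2.trans ?_)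
  · exact le_add_of_nonneg_right (by positivity)
  · exact le_add_of_nonneg_left (by positivity)

theorem intervalIntegrable_waveSemigroup_force {μ : ℝ} (hμ : 0 < μ) {t : ℝ} (ht : 0 ≤ t)
    {h : ℝ → L2 D} (hh : IntervalIntegrable h volume 0 t) :
    IntervalIntegrable (fun s => S.waveSemigroup hμ 0 (t - s) (S.force μ (h s))) volume 0 t := by
  rw [intervalIntegrable_iff_integrableOn_Ioc_of_le ht] at hh ⊢
  have hm : ∀ k i, AEStronglyMeasurable
      (fun s => S.mode (S.waveSemigroup hμ 0 (t - s) (S.force μ (h s))) k i)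
      (volume.restrict (Ioc 0 t)) := by
    intro k i
    have h1 : (fun s => S.mode (S.waveSemigroup hμ 0 (t - s) (S.force μ (h s))) k i) =
        fun s => μ⁻¹ * S.coeff (h s) k * S.waveMode μ (t - s) k ![0, 1] i := by
      funext s
      rw [mode_waveSemigroup, mode_force, waveMode_cons]
      ring
    rw [h1]
    refine (((S.continuous_coeff k).comp_aestronglyMeasurable hh.1).const_mul μ⁻¹).mul ?_
    exact ((S.continuous_waveMode μ k _ i).comp
      (continuous_const.sub continuous_id)).aestronglyMeasurable
  refine Integrable.mono' (hh.norm.const_mul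
    (√(2 / (μ * S.α 0)) + √(2 / (μ ^ 2 * S.α 0)))) ?_ ?_
  · exact (Hs.aestronglyMeasurable_of_coord S fun k => hm k 0).prodMk
      (Hs.aestronglyMeasurable_of_coord S fun k => hm k 1)
  · filter_upwards [ae_restrict_mem measurableSet_Ioc] with s hs
    exact S.norm_waveSemigroup_force_le hμ (by linarith [hs.2]) (h s)

/-- Fourier coefficients are continuous functionals and commute with the Bochner integral; this
reduces the mild equation to scalar identities. -/
theorem mode_integral_waveSemigroup_force {μ : ℝ} (hμ : 0 < μ) {t : ℝ} (ht : 0 ≤ t)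
    {h : ℝ → L2 D} (hh : IntervalIntegrable h volume 0 t) (k : ℕ) (i : Fin 2) :
    S.mode (∫ s in (0 : ℝ)..t, S.waveSemigroup hμ 0 (t - s) (S.force μ (h s))) k i =
      ∫ s in (0 : ℝ)..t, S.waveMode μ (t - s) k ![0, μ⁻¹ * S.coeff (h s) k] i := by
  rw [← modeL_apply, ← (S.modeL 0 k i).intervalIntegral_comp_comm
    (S.intervalIntegrable_waveSemigroup_force hμ ht hh)]
  simp only [modeL_apply, mode_waveSemigroup, mode_force]

theorem waveSemigroup_zero {μ : ℝ} (hμ : 0 < μ) (δ t : ℝ) :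
    S.waveSemigroup hμ δ t 0 = 0 := by
  refine mode_ext fun k i => ?_
  have h : S.mode (0 : S.Phase δ) k = 0 := funext fun j => S.mode_zero k j
  rw [mode_waveSemigroup, h, waveMode, Matrix.mulVec_zero]

theorem intervalIntegrable_of_memLp {T t : ℝ} (ht : t ∈ Icc 0 T) {ψ : ℝ → L2 D}
    (hψ : MemLp ψ 2 (volume.restrict (Ioo 0 T))) : IntervalIntegrable ψ volume 0 t := by
  rw [intervalIntegrable_iff_integrableOn_Ioo_of_le ht.1]
  exact IntegrableOn.mono_set (hψ.integrable one_le_two) (Ioo_subset_Ioo_right ht.2)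

theorem intervalIntegrable_comp_fst {B : L2 D → L2 D} (hB : Continuous B) {T t : ℝ}
    (ht : t ∈ Icc 0 T) {z : ℝ → S.Phase 0} (hz : ContinuousOn z (Icc 0 T)) :
    IntervalIntegrable (fun s => B (S.l2Equiv.symm (z s).1)) volume 0 t := by
  refine ContinuousOn.intervalIntegrable_of_Icc ht.1 ?_
  refine (hB.comp (S.l2Equiv.symm.continuous.comp continuous_fst)).comp_continuousOn ?_
  exact hz.mono (Icc_subset_Icc_right ht.2)

/-- A path started at rest is a mild solution if and only if all its modes satisfy Duhamel's
formula. -/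
theorem isMildSolution_iff {Q : L2 D →L[ℝ] L2 D} {B : L2 D → L2 D} (hB : Continuous B)
    {μ : ℝ} (hμ : 0 < μ) {T : ℝ} {ψ : ℝ → L2 D} (hψ : MemLp ψ 2 (volume.restrict (Ioo 0 T)))
    {z : ℝ → S.Phase 0} (hz0 : z 0 = 0) :
    S.IsMildSolution Q B hμ 0 T ψ z ↔ ContinuousOn z (Icc 0 T) ∧ ∀ t ∈ Icc 0 T, ∀ k i,
      S.mode (z t) k i = ∫ s in (0 : ℝ)..t, S.waveMode μ (t - s) k
        ![0, μ⁻¹ * S.coeff (B (S.l2Equiv.symm (z s).1) + Q (ψ s)) k] i := by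
  refine and_congr_right fun hz => forall₂_congr fun t ht => ?_
  have hBi := S.intervalIntegrable_comp_fst hB ht hz
  have hQi : IntervalIntegrable (fun s => Q (ψ s)) volume 0 t := by
    have h := intervalIntegrable_of_memLp ht hψ
    rw [intervalIntegrable_iff] at h ⊢
    exact Q.integrable_comp h
  rw [hz0, waveSemigroup_zero, zero_add,
    ← intervalIntegral.integral_add (S.intervalIntegrable_waveSemigroup_force hμ ht.1 hBi)
      (S.intervalIntegrable_waveSemigroup_force hμ ht.1 hQi)]
  have h1 : ∀ s, S.waveSemigroup hμ 0 (t - s) (S.force μ (B (S.l2Equiv.symm (z s).1))) +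
      S.waveSemigroup hμ 0 (t - s) (S.force μ (Q (ψ s))) =
      S.waveSemigroup hμ 0 (t - s) (S.force μ (B (S.l2Equiv.symm (z s).1) + Q (ψ s))) := by
    intro s
    refine mode_ext fun k i => ?_
    rw [mode_add, mode_waveSemigroup, mode_waveSemigroup, mode_waveSemigroup, mode_force,
      mode_force, mode_force, waveMode_cons, waveMode_cons _ _ _ _ _ (μ⁻¹ * S.coeff (Q (ψ s)) k),
      waveMode_cons _ _ _ _ _ (μ⁻¹ * S.coeff (B (S.l2Equiv.symm (z s).1) + Q (ψ s)) k),
      coeff_add, Pi.add_apply]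
    ring
  simp only [h1]
  constructor
  · intro h k i
    rw [h, S.mode_integral_waveSemigroup_force hμ ht.1 (hBi.add hQi)]
  · intro h
    refine mode_ext fun k i => ?_
    rw [h, S.mode_integral_waveSemigroup_force hμ ht.1 (hBi.add hQi)]

/-! ### Spatial regularity of controlled paths -/

/-- Cauchy–Schwarz against the constant function `1`. -/
theorem lintegral_sq_le {ν : Measure ℝ} {f : ℝ → ℝ≥0∞} (hf : AEMeasurable f ν) :
    (∫⁻ s, f s ∂ν) ^ 2 ≤ ν univ * ∫⁻ s, f s ^ 2 ∂ν := by
  have h := ENNReal.lintegral_mul_le_Lp_mul_Lq ν (p := 2) (q := 2) (by constructor <;> norm_num)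
    (aemeasurable_const (b := (1 : ℝ≥0∞))) hf
  simp only [Pi.mul_apply, one_mul, lintegral_const, ENNReal.rpow_ofNat, one_pow] at h
  refine (pow_le_pow_left₀ zero_le h 2).trans (le_of_eq ?_)
  have h2 : ∀ x : ℝ≥0∞, (x ^ (1 / 2 : ℝ)) ^ 2 = x := fun x => by
    rw [← ENNReal.rpow_natCast, ← ENNReal.rpow_mul]
    norm_num
  rw [mul_pow, h2, h2]

theorem enorm_sq_real (x : ℝ) : ‖x‖ₑ ^ 2 = ENNReal.ofReal (x ^ 2) := by
  rw [← ofReal_norm, ← ENNReal.ofReal_pow (norm_nonneg _), Real.norm_eq_abs, sq_abs]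

/-- Cauchy–Schwarz in time produces the factor `T`. The kernel bound `c` is left free so that
position and velocity are both covered. -/
theorem ofReal_duhamel_sq_le {μ c T t : ℝ} {k : ℕ} {i : Fin 2} (ht : t ∈ Icc 0 T) (hc : 0 ≤ c)
    (hwave : ∀ τ, 0 ≤ τ → ∀ b, S.waveMode μ τ k ![0, μ⁻¹ * b] i ^ 2 ≤ c * b ^ 2)
    {f : ℝ → ℝ} (hf : AEMeasurable f (volume.restrict (Ioo 0 T))) :
    ENNReal.ofReal ((∫ s in (0 : ℝ)..t, S.waveMode μ (t - s) k ![0, μ⁻¹ * f s] i) ^ 2) ≤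
      ENNReal.ofReal (c * T) * ∫⁻ s in Ioo 0 T, ENNReal.ofReal (f s ^ 2) := by
  have hft : AEMeasurable f (volume.restrict (Ioo 0 t)) :=
    hf.mono_measure (Measure.restrict_mono (Ioo_subset_Ioo_right ht.2) le_rfl)
  rw [← enorm_sq_real, intervalIntegral.integral_of_le ht.1, integral_Ioc_eq_integral_Ioo]
  have h1 : ‖∫ s in Ioo 0 t, S.waveMode μ (t - s) k ![0, μ⁻¹ * f s] i‖ₑ ≤
      ENNReal.ofReal (√c) * ∫⁻ s in Ioo 0 t, ‖f s‖ₑ := by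
    refine (enorm_integral_le_lintegral_enorm _).trans ?_
    rw [← lintegral_const_mul'' _ hft.enorm]
    refine setLIntegral_mono' measurableSet_Ioo fun s hs => ?_
    rw [← ofReal_norm, ← ofReal_norm, ← ENNReal.ofReal_mul (Real.sqrt_nonneg _)]
    refine ENNReal.ofReal_le_ofReal (abs_le_of_sq_le_sq' ?_ (by positivity) |>.2)
    rw [mul_pow, Real.sq_sqrt hc, Real.norm_eq_abs, Real.norm_eq_abs, sq_abs, sq_abs]
    exact hwave _ (by linarith [hs.2]) _
  refine (pow_le_pow_left₀ zero_le h1 2).trans ?_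
  rw [mul_pow, ← ENNReal.ofReal_pow (Real.sqrt_nonneg _), Real.sq_sqrt hc, ENNReal.ofReal_mul hc,
    mul_assoc]
  gcongr
  refine (lintegral_sq_le hft.enorm).trans ?_
  simp only [enorm_sq_real]
  gcongr
  · rw [Measure.restrict_apply_univ, Real.volume_Ioo, sub_zero]
    exact ENNReal.ofReal_le_ofReal ht.2
  · exact ht.2

/-- The energy weights the squared position by `α_k`; the resulting factor `α_k⁻¹` is the gain of
one order of smoothness. -/
theorem waveMode_force_fst_sq_le {μ : ℝ} (hμ : 0 < μ) (k : ℕ) {τ : ℝ} (hτ : 0 ≤ τ) (b : ℝ) :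
    S.waveMode μ τ k ![0, μ⁻¹ * b] 0 ^ 2 ≤ (S.α k)⁻¹ * (2 / μ) * b ^ 2 := by
  have h := S.waveMode_energy_le_two_mul hμ hτ k ![0, μ⁻¹ * b]
  simp only [Matrix.cons_val_zero, Matrix.cons_val_one] at h
  have h2 : 0 ≤ μ * S.waveMode μ τ k ![0, μ⁻¹ * b] 1 ^ 2 := by positivity
  rw [mul_assoc, le_inv_mul_iff₀ (S.pos k)]
  have h3 : 2 * (S.α k * 0 ^ 2 + μ * (μ⁻¹ * b) ^ 2) = 2 / μ * b ^ 2 := by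
    field_simp; ring
  linarith

theorem waveMode_force_snd_sq_le {μ : ℝ} (hμ : 0 < μ) (k : ℕ) {τ : ℝ} (hτ : 0 ≤ τ) (b : ℝ) :
    S.waveMode μ τ k ![0, μ⁻¹ * b] 1 ^ 2 ≤ μ⁻¹ * (2 / μ) * b ^ 2 := by
  have h := S.waveMode_energy_le_two_mul hμ hτ k ![0, μ⁻¹ * b]
  simp only [Matrix.cons_val_zero, Matrix.cons_val_one] at h
  have h2 : 0 ≤ S.α k * S.waveMode μ τ k ![0, μ⁻¹ * b] 0 ^ 2 :=
    mul_nonneg (S.pos k).le (sq_nonneg _)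
  rw [mul_assoc, le_inv_mul_iff₀ hμ]
  have h3 : 2 * (S.α k * 0 ^ 2 + μ * (μ⁻¹ * b) ^ 2) = 2 / μ * b ^ 2 := by
    field_simp; ring
  linarith

theorem lintegral_eSq {ν : Measure ℝ} {f : ℝ → L2 D} (hf : AEStronglyMeasurable f ν) (δ : ℝ) :
    ∫⁻ s, S.eSq δ (S.coeff (f s)) ∂ν =
      ∑' k, ENNReal.ofReal (S.α k ^ δ) * ∫⁻ s, ENNReal.ofReal (S.coeff (f s) k ^ 2) ∂ν := by
  have hm : ∀ k, AEMeasurable (fun s => ENNReal.ofReal (S.coeff (f s) k ^ 2)) ν := fun k =>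
    (((S.continuous_coeff k).comp_aestronglyMeasurable hf).aemeasurable.pow_const 2).ennreal_ofReal
  simp only [eSq, ENNReal.ofReal_mul (Real.rpow_nonneg (S.pos _).le δ)]
  rw [lintegral_tsum fun k => (hm k).const_mul _]
  exact tsum_congr fun k => lintegral_const_mul'' _ (hm k)

/-- One order of smoothness is gained by the wave flow from a forcing in `L²`. -/
theorem eSq_mode_le {μ : ℝ} (hμ : 0 < μ) {T : ℝ} {f : ℝ → L2 D}
    (hf : AEStronglyMeasurable f (volume.restrict (Ioo 0 T))) (b : ℝ) {t : ℝ}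
    (ht : t ∈ Icc 0 T) {z : S.Phase 0}
    (hz : ∀ k i, S.mode z k i =
      ∫ s in (0 : ℝ)..t, S.waveMode μ (t - s) k ![0, μ⁻¹ * S.coeff (f s) k] i) :
    S.eSq b z.1.1 ≤ ENNReal.ofReal (2 / μ * T) *
      ∫⁻ s in Ioo 0 T, S.eSq (b - 1) (S.coeff (f s)) ∧
    S.eSq (b - 1) z.2.1 ≤ ENNReal.ofReal (μ⁻¹ * (2 / μ) * T) *
      ∫⁻ s in Ioo 0 T, S.eSq (b - 1) (S.coeff (f s)) := by
  have hm : ∀ k, AEMeasurable (fun s => S.coeff (f s) k) (volume.restrict (Ioo 0 T)) := fun k =>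
    ((S.continuous_coeff k).comp_aestronglyMeasurable hf).aemeasurable
  rw [S.lintegral_eSq hf, ← ENNReal.tsum_mul_left, ← ENNReal.tsum_mul_left]
  constructor <;> refine ENNReal.tsum_le_tsum fun k => ?_
  · have hα := S.pos k
    have h := S.ofReal_duhamel_sq_le ht (by positivity)
      (fun τ hτ => S.waveMode_force_fst_sq_le hμ k hτ) (hm k)
    rw [← hz k 0] at h
    change ENNReal.ofReal (z.1.1 k ^ 2) ≤ _ at h
    have h3 : S.α k ^ b = S.α k ^ (b - 1) * S.α k := by
      rw [← Real.rpow_add_one hα.ne']; ring_nf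
    rw [ENNReal.ofReal_mul (by positivity)]
    refine (mul_le_mul_right h _).trans (le_of_eq ?_)
    rw [← mul_assoc, ← mul_assoc, ← ENNReal.ofReal_mul (by positivity),
      mul_comm (ENNReal.ofReal (2 / μ * T)), ← ENNReal.ofReal_mul (by positivity)]
    congr 2
    rw [h3]
    field_simp
  · have hα := S.pos k
    have h := S.ofReal_duhamel_sq_le ht (by positivity)
      (fun τ hτ => S.waveMode_force_snd_sq_le hμ k hτ) (hm k)
    rw [← hz k 1] at h
    change ENNReal.ofReal (z.2.1 k ^ 2) ≤ _ at h
    rw [ENNReal.ofReal_mul (by positivity), mul_left_comm]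
    exact mul_le_mul_right h _

/-- Since `λ_k² ≤ c² α_k^{-2β}`, the operator `Q` maps `H` boundedly into `H^{2β}`. -/
theorem eSq_coeff_apply_le {Q : L2 D →L[ℝ] L2 D} {lam : ℕ → ℝ} {c β : ℝ}
    (hQ : ∀ k, Q (S.e k) = lam k • S.e k) (hlam : ∀ k, |lam k| ≤ c * S.α k ^ (-β)) (f : L2 D) :
    S.eSq (2 * β) (S.coeff (Q f)) ≤ ENNReal.ofReal (c ^ 2) * S.eSq 0 (S.coeff f) := by
  rw [eSq, eSq, ← ENNReal.tsum_mul_left]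
  refine ENNReal.tsum_le_tsum fun k => ?_
  rw [← ENNReal.ofReal_mul (sq_nonneg c), S.coeff_apply_of_diagonal hQ, Real.rpow_zero, one_mul]
  refine ENNReal.ofReal_le_ofReal ?_
  have h1 : lam k ^ 2 ≤ (c * S.α k ^ (-β)) ^ 2 := sq_le_sq.2 ((hlam k).trans (le_abs_self _))
  have h2 : S.α k ^ (2 * β) * (S.α k ^ (-β)) ^ 2 = 1 := by
    rw [← Real.rpow_natCast, ← Real.rpow_mul (S.pos k).le, ← Real.rpow_add (S.pos k)]
    rw [show 2 * β + -β * ((2 : ℕ) : ℝ) = 0 by push_cast; ring, Real.rpow_zero]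
  have h3 := Real.rpow_nonneg (S.pos k).le (2 * β)
  calc S.α k ^ (2 * β) * (lam k * S.coeff f k) ^ 2
      = S.α k ^ (2 * β) * lam k ^ 2 * S.coeff f k ^ 2 := by ring
    _ ≤ S.α k ^ (2 * β) * (c * S.α k ^ (-β)) ^ 2 * S.coeff f k ^ 2 := by gcongr
    _ = c ^ 2 * (S.α k ^ (2 * β) * (S.α k ^ (-β)) ^ 2) * S.coeff f k ^ 2 := by ring
    _ = _ := by rw [h2, mul_one]

/-- A controlled path started at rest stays in `𝓗_{1+2β}`, with position bounded in
`H^{1+2β}`. -/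
theorem IsMildSolution.mem_hsSubmodule {Q : L2 D →L[ℝ] L2 D} {B : L2 D → L2 D} {β : ℝ}
    (hβ : 0 ≤ 1 + 2 * β) (hQ : S.IsDiagonalOfOrder Q β)
    (hB : ∀ δ ∈ Icc (0 : ℝ) (1 + 2 * β), S.IsSmallLipschitz B δ) (hB0 : B 0 = 0)
    {μ : ℝ} (hμ : 0 < μ) {T : ℝ} {ψ : ℝ → L2 D}
    (hψ : MemLp ψ 2 (volume.restrict (Ioo 0 T))) {z : ℝ → S.Phase 0} (hz0 : z 0 = 0)
    (hz : S.IsMildSolution Q B hμ 0 T ψ z) {t : ℝ} (ht : t ∈ Icc 0 T) :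
    (z t).1.1 ∈ S.hsSubmodule (1 + 2 * β) ∧ (z t).2.1 ∈ S.hsSubmodule (1 + 2 * β - 1) := by
  have hBc : Continuous B := (hB 0 ⟨le_rfl, hβ⟩).continuous
  obtain ⟨hzc, hmode⟩ := (S.isMildSolution_iff hBc hμ hψ hz0).1 hz
  obtain ⟨lam, hlam, c, hc, hcb⟩ := hQ
  have habs : ∀ k, |lam k| ≤ c * S.α k ^ (-β) := fun k => by
    have h1 : 0 ≤ lam k := le_trans
      (mul_nonneg (inv_nonneg.2 hc.le) (Real.rpow_nonneg (S.pos k).le _)) (hcb k).1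
    rw [abs_of_nonneg h1]
    exact (hcb k).2
  have hT : (0 : ℝ) ≤ T := ht.1.trans ht.2
  have hfm : AEStronglyMeasurable (fun s => B (S.l2Equiv.symm (z s).1) + Q (ψ s))
      (volume.restrict (Ioo 0 T)) := by
    refine AEStronglyMeasurable.add ?_ (Q.continuous.comp_aestronglyMeasurable hψ.1)
    exact (ContinuousOn.aestronglyMeasurable
      ((hBc.comp (S.l2Equiv.symm.continuous.comp continuous_fst)).comp_continuousOn
        (hzc.mono Ioo_subset_Icc_self)) measurableSet_Ioo)
  have hψ2 : ∫⁻ s in Ioo 0 T, S.eSq 0 (S.coeff (ψ s)) ≠ ⊤ := by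
    simp only [← enorm_sq_eq_eSq_coeff]
    have h := hψ.2
    rw [eLpNorm_lt_top_iff_lintegral_rpow_enorm_lt_top two_ne_zero ENNReal.ofNat_ne_top] at h
    simpa using h.ne
  -- From a position bounded in `H^a`, the forcing is square integrable in time with values in
  -- `H^{b-1}`: the condition `b ≤ a + 1` serves the term with `B`, and `b ≤ 1 + 2β` the term `Q ψ`.
  have hforce : ∀ a b : ℝ, a ∈ Icc 0 (1 + 2 * β) → b ≤ a + 1 → b ≤ 1 + 2 * β →
      ∀ C : ℝ≥0∞, C ≠ ⊤ → (∀ s ∈ Icc 0 T, S.eSq a (z s).1.1 ≤ C) →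
      ∫⁻ s in Ioo 0 T, S.eSq (b - 1) (S.coeff (B (S.l2Equiv.symm (z s).1) + Q (ψ s))) ≠ ⊤ := by
    intro a b ha hba hbβ C hC hbd
    obtain ⟨K, hK, hLip⟩ := (hB a ha).exists_eSq_le
    have hpt : ∀ s ∈ Ioo 0 T,
        S.eSq (b - 1) (S.coeff (B (S.l2Equiv.symm (z s).1) + Q (ψ s))) ≤
        2 * (ENNReal.ofReal (S.α 0 ^ (b - 1 - a)) * (ENNReal.ofReal K * C)) +
        2 * (ENNReal.ofReal (S.α 0 ^ (b - 1 - 2 * β)) *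
          (ENNReal.ofReal (c ^ 2) * S.eSq 0 (S.coeff (ψ s)))) := by
      intro s hs
      rw [coeff_add]
      refine (S.eSq_add_le _ _ _).trans ?_
      gcongr
      · refine (S.eSq_le_of_le (by linarith : b - 1 ≤ a) _).trans ?_
        gcongr
        have hmem : S.coeff (S.l2Equiv.symm (z s).1) ∈ S.hsSubmodule a := by
          rw [coeff_l2Equiv_symm, mem_hsSubmodule_iff_eSq_ne_top]
          exact ne_top_of_le_ne_top hC (hbd s (Ioo_subset_Icc_self hs))
        have h := hLip _ 0 hmem (by rw [coeff_zero]; exact Submodule.zero_mem _)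
        rw [hB0, sub_zero, sub_zero, coeff_l2Equiv_symm] at h
        refine h.trans ?_
        gcongr
        exact hbd s (Ioo_subset_Icc_self hs)
      · refine (S.eSq_le_of_le (by linarith : b - 1 ≤ 2 * β) _).trans ?_
        gcongr
        exact S.eSq_coeff_apply_le hlam habs _
    refine ne_top_of_le_ne_top ?_ (setLIntegral_mono' measurableSet_Ioo hpt)
    have hm : AEMeasurable (fun s => S.eSq 0 (S.coeff (ψ s))) (volume.restrict (Ioo 0 T)) := by
      simp only [← enorm_sq_eq_eSq_coeff]
      exact hψ.1.enorm.pow_const 2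
    rw [lintegral_add_left measurable_const, setLIntegral_const,
      lintegral_const_mul'' _ ((hm.const_mul _).const_mul _),
      lintegral_const_mul'' _ (hm.const_mul _), lintegral_const_mul'' _ hm, Real.volume_Ioo]
    finiteness
  -- Continuity in `H` starts the bootstrap. Each round gains one order, until the ceiling `1 + 2β`
  -- imposed by `Q` is reached.
  have hboot : ∀ n : ℕ, ∃ C : ℝ≥0∞, C ≠ ⊤ ∧
      ∀ s ∈ Icc 0 T, S.eSq (min (n : ℝ) (1 + 2 * β)) (z s).1.1 ≤ C := by
    intro n
    induction n with
    | zero =>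
      obtain ⟨C, hC⟩ := isCompact_Icc.exists_bound_of_continuousOn
        (continuous_fst.comp_continuousOn hzc)
      refine ⟨ENNReal.ofReal C ^ 2, by finiteness, fun s hs => ?_⟩
      rw [Nat.cast_zero, min_eq_left hβ, ← Hs.enorm_sq, ← ofReal_norm]
      gcongr
      exact hC s hs
    | succ n ih =>
      obtain ⟨C, hC, hbd⟩ := ih
      refine ⟨_, ENNReal.mul_ne_top ENNReal.ofReal_ne_top
        (hforce (min (n : ℝ) (1 + 2 * β)) (min ((n + 1 : ℕ) : ℝ) (1 + 2 * β))
          ⟨le_min n.cast_nonneg hβ, min_le_right _ _⟩ ?_ (min_le_right _ _) C hC hbd),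
        fun s hs => (S.eSq_mode_le hμ hfm _ hs (hmode s hs)).1⟩
      rcases le_total (n : ℝ) (1 + 2 * β) with h | h
      · rw [min_eq_left h]
        exact (min_le_left _ _).trans (by push_cast; rfl)
      · rw [min_eq_right h]
        exact (min_le_right _ _).trans (by linarith)
  obtain ⟨n, hn⟩ := exists_nat_ge (1 + 2 * β)
  obtain ⟨C, hC, hbd⟩ := hboot n
  rw [min_eq_right hn] at hbd
  -- A last round at `a = b = 1 + 2β` gives the velocity as well, in `H^{2β}`.
  have hfin := hforce (1 + 2 * β) (1 + 2 * β) ⟨hβ, le_rfl⟩ (by linarith) le_rfl C hC hbd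
  have h := S.eSq_mode_le hμ hfm (1 + 2 * β) ht (hmode t ht)
  rw [mem_hsSubmodule_iff_eSq_ne_top, mem_hsSubmodule_iff_eSq_ne_top]
  exact ⟨ne_top_of_le_ne_top (by finiteness) h.1, ne_top_of_le_ne_top (by finiteness) h.2⟩

/-! ### Steering the linear wave equation -/

/-- A smooth step: it vanishes on `(-∞, 0]`, reaches `1` at `1` with zero slope, and has bounded
first and second derivatives up to time `1`. -/
structure SmoothStep where
  φ : ℝ → ℝ
  φ₁ : ℝ → ℝ
  φ₂ : ℝ → ℝ
  bound : ℝ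
  hasDerivAt : ∀ s, HasDerivAt φ (φ₁ s) s
  hasDerivAt₁ : ∀ s, HasDerivAt φ₁ (φ₂ s) s
  continuous₂ : Continuous φ₂
  eq_zero : ∀ s ≤ 0, φ s = 0
  eq_zero₁ : ∀ s ≤ 0, φ₁ s = 0
  eq_zero₂ : ∀ s < 0, φ₂ s = 0
  at_one : φ 1 = 1
  at_one₁ : φ₁ 1 = 0
  sq_le : ∀ s, φ s ^ 2 ≤ 1
  sq_le₁ : ∀ s ∈ Icc (0 : ℝ) 1, φ₁ s ^ 2 ≤ bound
  sq_le₂ : ∀ s ∈ Icc (0 : ℝ) 1, φ₂ s ^ 2 ≤ bound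

/-- `Real.smoothTransition` works: its slope vanishes on `(-∞, 0]` and at `1` because it attains its
minimum, respectively its maximum, there. One compactness bound on the sum of the squared
derivatives serves for both. -/
theorem SmoothStep.nonempty : Nonempty SmoothStep := by
  have hc2 : ContDiff ℝ 2 Real.smoothTransition := Real.smoothTransition.contDiff (n := 2)
  have hc1 : ContDiff ℝ 1 (deriv Real.smoothTransition) := by
    have h : ContDiff ℝ (1 + 1) Real.smoothTransition := by simpa [one_add_one_eq_two] using hc2
    exact (contDiff_succ_iff_deriv.1 h).2.2
  have hc0 : Continuous (deriv (deriv Real.smoothTransition)) := hc1.continuous_deriv le_rfl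
  have hz1 : ∀ s ≤ 0, deriv Real.smoothTransition s = 0 := fun s hs =>
    IsLocalMin.deriv_eq_zero (Eventually.of_forall fun r => by
      rw [Real.smoothTransition.zero_of_nonpos hs]; exact Real.smoothTransition.nonneg r)
  obtain ⟨K, hK⟩ := isCompact_Icc.exists_bound_of_continuousOn (s := Icc (0 : ℝ) 1)
    ((hc1.continuous.pow 2).add (hc0.pow 2)).continuousOn
  refine ⟨⟨Real.smoothTransition, deriv Real.smoothTransition,
    deriv (deriv Real.smoothTransition), K,
    fun s => (hc2.differentiable (by norm_num) s).hasDerivAt,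
    fun s => (hc1.differentiable (by norm_num) s).hasDerivAt, hc0,
    fun s hs => Real.smoothTransition.zero_of_nonpos hs, hz1, fun s hs => ?_,
    Real.smoothTransition.one, ?_, fun s => ?_, fun s hs => ?_, fun s hs => ?_⟩⟩
  · have h : deriv Real.smoothTransition =ᶠ[𝓝 s] fun _ => 0 := by
      filter_upwards [Iio_mem_nhds hs] with r hr using hz1 r hr.le
    rw [h.deriv_eq, deriv_const]
  · exact IsLocalMax.deriv_eq_zero (Eventually.of_forall fun r => by
      rw [Real.smoothTransition.one]; exact Real.smoothTransition.le_one r)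
  · exact pow_le_one₀ (Real.smoothTransition.nonneg s) (Real.smoothTransition.le_one s)
  · have h := (le_abs_self _).trans (hK s hs)
    simp only [Pi.add_apply, Pi.pow_apply] at h
    linarith [sq_nonneg (deriv (deriv Real.smoothTransition) s)]
  · have h := (le_abs_self _).trans (hK s hs)
    simp only [Pi.add_apply, Pi.pow_apply] at h
    linarith [sq_nonneg (deriv Real.smoothTransition s)]

theorem SmoothStep.bound_nonneg (F : SmoothStep) : 0 ≤ F.bound :=
  (sq_nonneg _).trans (F.sq_le₁ 0 ⟨le_rfl, zero_le_one⟩)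

theorem hsIncl_coe {δ δ' : ℝ} (h : δ' ≤ δ) (x : S.Hs δ) : (S.hsIncl h x).1 = x.1 := by
  unfold hsIncl
  exact Subtype.coe_mk _ _

theorem norm_hsIncl_le {δ δ' : ℝ} (h : δ' ≤ δ) (x : S.Hs δ) :
    ‖S.hsIncl h x‖ ≤ √(S.α 0 ^ (δ' - δ)) * ‖x‖ := by
  refine Hs.norm_le_of_eSq_le S (Real.rpow_nonneg (S.pos 0).le _) ?_
  rw [hsIncl_coe]
  exact S.eSq_le_of_le h x.1

theorem hsIncl_sub {δ δ' : ℝ} (h : δ' ≤ δ) (x y : S.Hs δ) :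
    S.hsIncl h (x - y) = S.hsIncl h x - S.hsIncl h y :=
  Subtype.ext rfl

theorem continuous_hsIncl {δ δ' : ℝ} (h : δ' ≤ δ) : Continuous (S.hsIncl h) := by
  refine (LipschitzWith.of_dist_le_mul (K := (√(S.α 0 ^ (δ' - δ))).toNNReal)
    fun x y => ?_).continuous
  rw [dist_eq_norm, dist_eq_norm, Real.coe_toNNReal _ (Real.sqrt_nonneg _), ← hsIncl_sub]
  exact S.norm_hsIncl_le h (x - y)

/-- The path that runs from rest to `q` during `[T - 1, T]`: the backward wave flow from `q`,
multiplied in position by a smooth step. -/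
def steerPath (F : SmoothStep) {μ : ℝ} (hμ : 0 < μ) (T : ℝ) (q : S.Phase 0) (t : ℝ) :
    S.Phase 0 :=
  (F.φ (t - (T - 1)) • (S.waveSemigroup hμ 0 (T - t) (q.1, -q.2)).1,
    F.φ₁ (t - (T - 1)) • S.hsIncl (by norm_num) (S.waveSemigroup hμ 0 (T - t) (q.1, -q.2)).1 -
      F.φ (t - (T - 1)) • (S.waveSemigroup hμ 0 (T - t) (q.1, -q.2)).2)

/-- The `k`-th coefficient of the forcing that produces `steerPath`. -/
def steerForce (F : SmoothStep) (μ T : ℝ) (w : Fin 2 → ℝ) (k : ℕ) (t : ℝ) : ℝ :=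
  μ * F.φ₂ (t - (T - 1)) * S.waveMode μ (T - t) k w 0
    - 2 * μ * F.φ₁ (t - (T - 1)) * S.waveMode μ (T - t) k w 1
    - 2 * F.φ (t - (T - 1)) * S.waveMode μ (T - t) k w 1
    + F.φ₁ (t - (T - 1)) * S.waveMode μ (T - t) k w 0

theorem SmoothStep.continuous (F : SmoothStep) : Continuous F.φ :=
  continuous_iff_continuousAt.2 fun s => (F.hasDerivAt s).continuousAt

theorem SmoothStep.continuous₁ (F : SmoothStep) : Continuous F.φ₁ :=
  continuous_iff_continuousAt.2 fun s => (F.hasDerivAt₁ s).continuousAt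

theorem mode_steerPath (F : SmoothStep) {μ : ℝ} (hμ : 0 < μ) (T : ℝ) (q : S.Phase 0) (t : ℝ)
    (k : ℕ) : S.mode (S.steerPath F hμ T q t) k =
      ![F.φ (t - (T - 1)) * S.waveMode μ (T - t) k ![q.1.1 k, -q.2.1 k] 0,
        F.φ₁ (t - (T - 1)) * S.waveMode μ (T - t) k ![q.1.1 k, -q.2.1 k] 0
          - F.φ (t - (T - 1)) * S.waveMode μ (T - t) k ![q.1.1 k, -q.2.1 k] 1] :=
  rfl

theorem continuous_waveMode_sub (μ T : ℝ) (k : ℕ) (w : Fin 2 → ℝ) (i : Fin 2) :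
    Continuous fun t => S.waveMode μ (T - t) k w i :=
  (S.continuous_waveMode μ k w i).comp (continuous_const.sub continuous_id)

theorem continuous_steerForce (F : SmoothStep) (μ T : ℝ) (w : Fin 2 → ℝ) (k : ℕ) :
    Continuous (S.steerForce F μ T w k) := by
  have h0 := S.continuous_waveMode_sub μ T k w 0
  have h1 := S.continuous_waveMode_sub μ T k w 1
  have hs : Continuous fun t : ℝ => t - (T - 1) := by fun_prop
  have hφ := F.continuous.comp hs
  have hφ₁ := F.continuous₁.comp hs
  have hφ₂ := F.continuous₂.comp hs
  simp only [Function.comp_def] at hφ hφ₁ hφ₂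
  unfold steerForce
  fun_prop

/-- If `y` is a free damped mode, `x(t) = y(T - t)` satisfies `μx'' + x' + αx = 2x'`. For `φx` the
forcing is therefore `2φx' + μφ''x + 2μφ'x' + φ'x`, which is `steerForce` because `x' = -y'(T - t)`.
-/
theorem mode_steerPath_duhamel (F : SmoothStep) {μ : ℝ} (hμ : 0 < μ) {T : ℝ} (hT : 1 ≤ T)
    (q : S.Phase 0) (t : ℝ) (k : ℕ) (i : Fin 2) :
    S.mode (S.steerPath F hμ T q t) k i = ∫ s in (0 : ℝ)..t, S.waveMode μ (t - s) k
      ![0, μ⁻¹ * S.steerForce F μ T ![q.1.1 k, -q.2.1 k] k s] i := by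
  set w : Fin 2 → ℝ := ![q.1.1 k, -q.2.1 k] with hw
  have hrev : ∀ s : ℝ, HasDerivAt (fun s => T - s) (-1) s := fun s => by
    simpa using (hasDerivAt_id s).const_sub T
  have hshift : ∀ s : ℝ, HasDerivAt (fun s => s - (T - 1)) 1 s := fun s =>
    (hasDerivAt_id s).sub_const _
  have hc0 : ∀ s, HasDerivAt (fun s => S.waveMode μ (T - s) k w 0)
      (-S.waveMode μ (T - s) k w 1) s := fun s => by
    simpa [Function.comp_def] using (S.waveMode_hasDerivAt_fst μ (T - s) k w).scomp s (hrev s)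
  have hc1 : ∀ s, HasDerivAt (fun s => S.waveMode μ (T - s) k w 1)
      (S.α k / μ * S.waveMode μ (T - s) k w 0 + 1 / μ * S.waveMode μ (T - s) k w 1) s :=
    fun s => by
      have h := (S.waveMode_hasDerivAt_snd μ (T - s) k w).scomp s (hrev s)
      refine h.congr_deriv ?_
      rw [smul_eq_mul]
      ring
  have hφ : ∀ s, HasDerivAt (fun s => F.φ (s - (T - 1))) (F.φ₁ (s - (T - 1))) s := fun s => by
    simpa [Function.comp_def] using (F.hasDerivAt (s - (T - 1))).scomp s (hshift s)
  have hφ₁ : ∀ s, HasDerivAt (fun s => F.φ₁ (s - (T - 1))) (F.φ₂ (s - (T - 1))) s := fun s => by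
    simpa [Function.comp_def] using (F.hasDerivAt₁ (s - (T - 1))).scomp s (hshift s)
  rw [mode_steerPath]
  refine S.waveMode_duhamel μ k
    (w₀ := fun t => F.φ (t - (T - 1)) * S.waveMode μ (T - t) k w 0)
    (w₁ := fun t => F.φ₁ (t - (T - 1)) * S.waveMode μ (T - t) k w 0
      - F.φ (t - (T - 1)) * S.waveMode μ (T - t) k w 1)
    (S.continuous_steerForce F μ T w k) (fun s => ?_) (fun s => ?_) ?_ ?_ t i
  · refine ((hφ s).mul (hc0 s)).congr_deriv ?_
    ring
  · refine (((hφ₁ s).mul (hc0 s)).sub ((hφ s).mul (hc1 s))).congr_deriv ?_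
    simp only [steerForce]
    field_simp
    ring
  · simp only [F.eq_zero (0 - (T - 1)) (by linarith), zero_mul]
  · simp only [F.eq_zero (0 - (T - 1)) (by linarith), F.eq_zero₁ (0 - (T - 1)) (by linarith),
      zero_mul, sub_zero]

theorem steerPath_zero (F : SmoothStep) {μ : ℝ} (hμ : 0 < μ) {T : ℝ} (hT : 1 ≤ T)
    (q : S.Phase 0) : S.steerPath F hμ T q 0 = 0 := by
  rw [steerPath, F.eq_zero (0 - (T - 1)) (by linarith), F.eq_zero₁ (0 - (T - 1)) (by linarith)]
  simp only [zero_smul, sub_zero]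
  rfl

/-- Time reversal flips the velocity: the backward flow starts from `-q.2`, and the minus sign in
the second component of the path restores `q.2`. -/
theorem steerPath_end (F : SmoothStep) {μ : ℝ} (hμ : 0 < μ) (T : ℝ) (q : S.Phase 0) :
    S.steerPath F hμ T q T = q := by
  refine mode_ext fun k i => ?_
  rw [mode_steerPath, sub_self, waveMode_zero, show T - (T - 1) = 1 by ring, F.at_one, F.at_one₁]
  fin_cases i <;> simp [mode]

theorem continuousOn_steerPath (F : SmoothStep) {μ : ℝ} (hμ : 0 < μ) (T : ℝ) (q : S.Phase 0) :
    ContinuousOn (S.steerPath F hμ T q) (Icc 0 T) := by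
  have hy : ContinuousOn (fun t => S.waveSemigroup hμ 0 (T - t) (q.1, -q.2)) (Icc 0 T) :=
    (S.continuousOn_waveSemigroup hμ 0 (q.1, -q.2)).comp (by fun_prop)
      fun t ht => sub_nonneg.2 ht.2
  have hs : Continuous fun t : ℝ => t - (T - 1) := by fun_prop
  have hφ := (F.continuous.comp hs).continuousOn (s := Icc 0 T)
  have hφ₁ := (F.continuous₁.comp hs).continuousOn (s := Icc 0 T)
  exact (hφ.smul (continuous_fst.comp_continuousOn hy)).prodMk
    ((hφ₁.smul ((S.continuous_hsIncl _).comp_continuousOn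
      (continuous_fst.comp_continuousOn hy))).sub
      (hφ.smul (continuous_snd.comp_continuousOn hy)))

/-- The forcing and the position of the steering path are controlled by the energy of the target
and by the velocity of the backward flow. -/
theorem steerForce_sq_add_le (F : SmoothStep) {μ : ℝ} (hμ : 0 < μ) {L : ℝ} (hL : 0 ≤ L)
    (T : ℝ) (w : Fin 2 → ℝ) (k : ℕ) {t : ℝ} (ht : t ∈ Icc (T - 1) T) :
    S.steerForce F μ T w k t ^ 2 +
        L * (S.α k * (F.φ (t - (T - 1)) * S.waveMode μ (T - t) k w 0) ^ 2) ≤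
      (1 + μ ^ 2) * (8 * F.bound / S.α 0 + 16 * (1 + F.bound) + 2 * L) *
        (S.α k * w 0 ^ 2 + μ * w 1 ^ 2 + S.waveMode μ (T - t) k w 1 ^ 2) := by
  have hα0 := S.pos 0
  have hαk := S.pos k
  have hK := F.bound_nonneg
  have hs : t - (T - 1) ∈ Icc (0 : ℝ) 1 := ⟨by linarith [ht.1], by linarith [ht.2]⟩
  have hen := S.waveMode_energy_le_two_mul hμ (sub_nonneg.2 ht.2) k w
  have hp := F.sq_le (t - (T - 1))
  have hp1 := F.sq_le₁ _ hs
  have hp2 := F.sq_le₂ _ hs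
  unfold steerForce
  set x := S.waveMode μ (T - t) k w 0
  set y := S.waveMode μ (T - t) k w 1
  set E := S.α k * w 0 ^ 2 + μ * w 1 ^ 2 with hE
  set p := F.φ (t - (T - 1))
  set p1 := F.φ₁ (t - (T - 1))
  set p2 := F.φ₂ (t - (T - 1))
  set K := F.bound
  have hE0 : 0 ≤ E := by positivity
  have hx : S.α k * x ^ 2 ≤ 2 * E := le_trans (le_add_of_nonneg_right (by positivity)) hen
  have hx0 : x ^ 2 ≤ 2 * E / S.α 0 := by
    rw [le_div_iff₀ hα0]
    nlinarith [mul_le_mul_of_nonneg_right (S.mono (Nat.zero_le k)) (sq_nonneg x)]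
  -- The square of a sum of four terms is at most four times the sum of the squares.
  have h1 : (μ * p2 * x - 2 * μ * p1 * y - 2 * p * y + p1 * x) ^ 2 ≤
      4 * (μ ^ 2 * p2 ^ 2 * x ^ 2 + 4 * μ ^ 2 * p1 ^ 2 * y ^ 2 + 4 * p ^ 2 * y ^ 2
        + p1 ^ 2 * x ^ 2) := by
    linarith [sq_nonneg (μ * p2 * x + 2 * μ * p1 * y), sq_nonneg (μ * p2 * x + 2 * p * y),
      sq_nonneg (μ * p2 * x - p1 * x), sq_nonneg (2 * μ * p1 * y - 2 * p * y),
      sq_nonneg (2 * μ * p1 * y + p1 * x), sq_nonneg (2 * p * y + p1 * x)]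
  have h2 : 4 * (μ ^ 2 * p2 ^ 2 * x ^ 2 + 4 * μ ^ 2 * p1 ^ 2 * y ^ 2 + 4 * p ^ 2 * y ^ 2
        + p1 ^ 2 * x ^ 2) ≤
      4 * (μ ^ 2 * K * (2 * E / S.α 0) + 4 * μ ^ 2 * K * y ^ 2 + 4 * 1 * y ^ 2
        + K * (2 * E / S.α 0)) := by
    gcongr
  have h3 : L * (S.α k * (p * x) ^ 2) ≤ L * (2 * E) := by
    refine mul_le_mul_of_nonneg_left (le_trans ?_ hx) hL
    rw [mul_pow]
    have : p ^ 2 * x ^ 2 ≤ 1 * x ^ 2 := by gcongr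
    nlinarith
  refine (add_le_add (h1.trans h2) h3).trans ?_
  -- The constant is generous enough for the difference of the two sides to be a sum of nonnegative
  -- terms.
  have h4 : (1 + μ ^ 2) * (8 * K / S.α 0 + 16 * (1 + K) + 2 * L) * (E + y ^ 2) =
      4 * (μ ^ 2 * K * (2 * E / S.α 0) + 4 * μ ^ 2 * K * y ^ 2 + 4 * 1 * y ^ 2
        + K * (2 * E / S.α 0)) + L * (2 * E) + ((1 + μ ^ 2) * (8 * K / S.α 0) * y ^ 2
        + (1 + μ ^ 2) * (16 * (1 + K)) * E + 16 * μ ^ 2 * y ^ 2 + 16 * K * y ^ 2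
        + (1 + μ ^ 2) * (2 * L) * y ^ 2 + μ ^ 2 * (2 * L) * E) := by
    field_simp
    ring
  rw [h4]
  exact le_add_of_nonneg_right (by positivity)

theorem steerForce_eq_zero (F : SmoothStep) (μ : ℝ) {T : ℝ} (w : Fin 2 → ℝ) (k : ℕ) {t : ℝ}
    (ht : t < T - 1) : S.steerForce F μ T w k t = 0 := by
  rw [steerForce, F.eq_zero _ (by linarith), F.eq_zero₁ _ (by linarith),
    F.eq_zero₂ _ (by linarith)]
  ring

/-- Over unit time the constant energy contributes once and the dissipated velocity at most once
more, hence the factor `2`. That this bound needs no `1/μ` is the source of uniformity in `μ`. -/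
theorem lintegral_waveMode_snd_sq_le {μ : ℝ} (hμ : 0 < μ) (T : ℝ) (k : ℕ) (w : Fin 2 → ℝ) :
    ∫⁻ t in Icc (T - 1) T, ENNReal.ofReal
      (S.α k * w 0 ^ 2 + μ * w 1 ^ 2 + S.waveMode μ (T - t) k w 1 ^ 2) ≤
      ENNReal.ofReal (2 * (S.α k * w 0 ^ 2 + μ * w 1 ^ 2)) := by
  have hα := (S.pos k).le
  have hc : Continuous fun t => S.waveMode μ (T - t) k w 1 ^ 2 :=
    (S.continuous_waveMode_sub μ T k w 1).pow 2
  have hc' : Continuous fun t => S.α k * w 0 ^ 2 + μ * w 1 ^ 2 + S.waveMode μ (T - t) k w 1 ^ 2 :=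
    continuous_const.add hc
  rw [← ofReal_integral_eq_lintegral_ofReal hc'.continuousOn.integrableOn_Icc
    (Eventually.of_forall fun t => by simp only [Pi.zero_apply]; positivity)]
  refine ENNReal.ofReal_le_ofReal ?_
  rw [integral_Icc_eq_integral_Ioc, ← intervalIntegral.integral_of_le (by linarith),
    intervalIntegral.integral_add (by simp) (hc.intervalIntegrable _ _),
    intervalIntegral.integral_const,
    intervalIntegral.integral_comp_sub_left (fun s => S.waveMode μ s k w 1 ^ 2) T, sub_self,
    sub_sub_cancel, one_smul]
  linarith [S.integral_waveMode_snd_sq_le hμ 1 k w]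

/-! ### Controls that realize a perturbation of the end point -/

/-- Weighted by `α_k^{2β}`, the energies sum to the squared `H^{1+2β}` norm of the position plus `μ`
times the squared `H^{2β}` norm of the velocity. -/
theorem tsum_energy_le {β μ : ℝ} (hμ : 0 < μ) (r : S.Phase (1 + 2 * β)) :
    ∑' k, ENNReal.ofReal (S.α k ^ (2 * β) * (S.α k * r.1.1 k ^ 2 + μ * r.2.1 k ^ 2)) ≤
      ENNReal.ofReal ((1 + μ) * ‖r‖ ^ 2) := by
  have hα : ∀ k, S.α k ^ (1 + 2 * β) = S.α k ^ (2 * β) * S.α k := fun k => by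
    rw [← Real.rpow_add_one (S.pos k).ne']; ring_nf
  have h1 : ∀ k, ENNReal.ofReal (S.α k ^ (2 * β) * (S.α k * r.1.1 k ^ 2 + μ * r.2.1 k ^ 2)) =
      ENNReal.ofReal (S.α k ^ (1 + 2 * β) * r.1.1 k ^ 2) +
        ENNReal.ofReal μ * ENNReal.ofReal (S.α k ^ (2 * β) * r.2.1 k ^ 2) := by
    intro k
    rw [← ENNReal.ofReal_mul hμ.le, ← ENNReal.ofReal_add (S.rpow_mul_sq_nonneg _ _ _)
      (mul_nonneg hμ.le (S.rpow_mul_sq_nonneg _ _ _)), hα]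
    congr 1
    ring
  have h2 : ∀ x, S.eSq (1 + 2 * β - 1) x = S.eSq (2 * β) x := fun x => by
    congr 1
    ring
  simp only [h1]
  rw [ENNReal.tsum_add, ENNReal.tsum_mul_left]
  change S.eSq (1 + 2 * β) r.1.1 + ENNReal.ofReal μ * S.eSq (2 * β) r.2.1 ≤ _
  rw [← h2, ← Hs.enorm_sq S r.1, ← Hs.enorm_sq S r.2, ← ofReal_norm, ← ofReal_norm,
    ← ENNReal.ofReal_pow (norm_nonneg _), ← ENNReal.ofReal_pow (norm_nonneg _),
    ← ENNReal.ofReal_mul hμ.le, ← ENNReal.ofReal_add (by positivity) (by positivity)]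
  refine ENNReal.ofReal_le_ofReal ?_
  have h3 : ‖r.1‖ ^ 2 ≤ ‖r‖ ^ 2 := by gcongr; exact norm_fst_le r
  have h4 : ‖r.2‖ ^ 2 ≤ ‖r‖ ^ 2 := by gcongr; exact norm_snd_le r
  nlinarith

/-- A sequence whose diagonal image dominates it is controlled by the `H^{2β}` norm of the
image. -/
theorem eSq_inv_mul_le {lam : ℕ → ℝ} {c β : ℝ} (hc : 0 < c)
    (hlam : ∀ k, c⁻¹ * S.α k ^ (-β) ≤ lam k) (x : ℕ → ℝ) :
    S.eSq 0 (fun k => (lam k)⁻¹ * x k) ≤ ENNReal.ofReal (c ^ 2) * S.eSq (2 * β) x := by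
  rw [eSq, eSq, ← ENNReal.tsum_mul_left]
  refine ENNReal.tsum_le_tsum fun k => ?_
  rw [← ENNReal.ofReal_mul (sq_nonneg c), Real.rpow_zero, one_mul]
  refine ENNReal.ofReal_le_ofReal ?_
  have hα := Real.rpow_pos_of_pos (S.pos k) (-β)
  have h1 : (lam k)⁻¹ ≤ (c⁻¹ * S.α k ^ (-β))⁻¹ := inv_anti₀ (by positivity) (hlam k)
  have h0 : 0 ≤ (lam k)⁻¹ := inv_nonneg.2 (le_trans (by positivity) (hlam k))
  have h2 : (c⁻¹ * S.α k ^ (-β))⁻¹ = c * S.α k ^ β := by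
    rw [mul_inv, inv_inv, Real.rpow_neg (S.pos k).le, inv_inv]
  have h3 : S.α k ^ (2 * β) = (S.α k ^ β) ^ 2 := by
    rw [← Real.rpow_natCast, ← Real.rpow_mul (S.pos k).le]
    congr 1
    push_cast
    ring
  rw [h2] at h1
  calc ((lam k)⁻¹ * x k) ^ 2 = (lam k)⁻¹ ^ 2 * x k ^ 2 := mul_pow _ _ _
    _ ≤ (c * S.α k ^ β) ^ 2 * x k ^ 2 := by gcongr
    _ = _ := by rw [h3]; ring

/-- The forcing of a steering path, corrected by a perturbation `P` that is dominated by the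
path, is the image under `Q` of a control whose size is that of the target. -/
theorem exists_steering_control {Q : L2 D →L[ℝ] L2 D} {β : ℝ} (hQ : S.IsDiagonalOfOrder Q β)
    (F : SmoothStep) {L : ℝ} (hL : 0 ≤ L) :
    ∃ M : ℝ, 0 ≤ M ∧ ∀ {μ : ℝ} (hμ : 0 < μ) {T : ℝ} (r : S.Phase (1 + 2 * β))
      (q : S.Phase 0) (P : ℝ → L2 D), q.1.1 = r.1.1 → q.2.1 = r.2.1 →
      ContinuousOn P (Icc 0 T) →
      (∀ t ∈ Icc 0 T, S.eSq (1 + 2 * β) (S.coeff (P t)) ≤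
        ENNReal.ofReal L * S.eSq (1 + 2 * β) (S.steerPath F hμ T q t).1.1) →
      ∃ η : ℝ → L2 D, AEStronglyMeasurable η (volume.restrict (Ioo 0 T)) ∧
        (∀ t ∈ Icc 0 T, ∀ k,
          S.coeff (P t + Q (η t)) k = S.steerForce F μ T ![q.1.1 k, -q.2.1 k] k t) ∧
        eLpNorm η 2 (volume.restrict (Ioo 0 T)) ≤ ENNReal.ofReal (M * (1 + μ) ^ 2 * ‖r‖) := by
  obtain ⟨lam, hlam, c, hc, hcb⟩ := hQ
  -- Only the `H^{2β}` norm of `P` is needed; `L'` includes the constant of the embedding of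
  -- `H^{1+2β}`.
  set L' : ℝ := S.α 0 ^ (2 * β - (1 + 2 * β)) * L with hL'
  have hL'0 : 0 ≤ L' := mul_nonneg (Real.rpow_nonneg (S.pos 0).le _) hL
  set A : ℝ := 8 * F.bound / S.α 0 + 16 * (1 + F.bound) + 2 * L' with hA
  have hA0 : 0 ≤ A := by
    have := F.bound_nonneg
    have := S.pos 0
    positivity
  -- One factor `2` comes from splitting forcing and perturbation, the other from the time integral;
  -- `c²` is the cost of inverting `Q`.
  refine ⟨√(4 * c ^ 2 * A), Real.sqrt_nonneg _, ?_⟩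
  intro μ hμ T r q P hq1 hq2 hP hPle
  set w : ℕ → Fin 2 → ℝ := fun k => ![q.1.1 k, -q.2.1 k] with hw
  set g : ℝ → ℕ → ℝ := fun t k => S.steerForce F μ T (w k) k t with hg
  set x : ℝ → ℕ → ℝ := fun t => (S.steerPath F hμ T q t).1.1 with hx
  have hx' : ∀ t k, x t k = F.φ (t - (T - 1)) * S.waveMode μ (T - t) k (w k) 0 :=
    fun t k => rfl
  set e : ℕ → ℝ := fun k => S.α k * w k 0 ^ 2 + μ * w k 1 ^ 2 with he
  have he0 : ∀ k, 0 ≤ e k := fun k => by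
    have := (S.pos k).le
    positivity
  have hesum : ∑' k, ENNReal.ofReal (S.α k ^ (2 * β) * e k) ≤
      ENNReal.ofReal ((1 + μ) * ‖r‖ ^ 2) := by
    refine le_trans (le_of_eq (tsum_congr fun k => ?_)) (S.tsum_energy_le hμ r)
    simp only [he, hw, hq1, hq2, Matrix.cons_val_zero, Matrix.cons_val_one, neg_sq]
  -- These are the coefficients of the control obtained by inverting `Q` on forcing minus
  -- perturbation.
  set E : ℝ → ℕ → ℝ := fun t k => (lam k)⁻¹ * (g t k - S.coeff (P t) k) with hE
  set W : ℕ → ℝ → ℝ≥0∞ := fun k => indicator (Icc (T - 1) T) fun t =>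
    ENNReal.ofReal (e k + S.waveMode μ (T - t) k (w k) 1 ^ 2) with hW
  have hα2 : ∀ k, 0 ≤ S.α k ^ (2 * β) := fun k => Real.rpow_nonneg (S.pos k).le _
  have hterm : ∀ t ∈ Icc 0 T, ∀ k,
      ENNReal.ofReal (S.α k ^ (2 * β) * (g t k ^ 2 + L' * (S.α k * x t k ^ 2))) ≤
        ENNReal.ofReal ((1 + μ ^ 2) * A) * (ENNReal.ofReal (S.α k ^ (2 * β)) * W k t) := by
    intro t ht k
    by_cases hts : t ∈ Icc (T - 1) T
    · rw [hW]
      simp only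
      rw [indicator_of_mem hts, ← ENNReal.ofReal_mul (hα2 k), ← ENNReal.ofReal_mul (by positivity)]
      refine ENNReal.ofReal_le_ofReal ?_
      exact (mul_le_mul_of_nonneg_left
        (S.steerForce_sq_add_le F hμ hL'0 T (w k) k hts) (hα2 k)).trans
        (le_of_eq (mul_left_comm _ _ _))
    · have hlt : t < T - 1 := by
        by_contra h
        exact hts ⟨not_lt.1 h, ht.2⟩
      have h1 : g t k = 0 := S.steerForce_eq_zero F μ (w k) k hlt
      have h2 : x t k = 0 := by rw [hx', F.eq_zero _ (by linarith), zero_mul]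
      simp [h1, h2]
  have hpt : ∀ t ∈ Icc 0 T, S.eSq 0 (E t) ≤ ENNReal.ofReal (2 * c ^ 2 * ((1 + μ ^ 2) * A)) *
      ∑' k, ENNReal.ofReal (S.α k ^ (2 * β)) * W k t := by
    intro t ht
    have h1 : S.eSq (2 * β) (fun k => g t k - S.coeff (P t) k) ≤
        2 * S.eSq (2 * β) (g t) + 2 * S.eSq (2 * β) (S.coeff (P t)) := by
      have h := S.eSq_add_le (2 * β) (g t) (-S.coeff (P t))
      have hneg : S.eSq (2 * β) (-S.coeff (P t)) = S.eSq (2 * β) (S.coeff (P t)) := by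
        simp [eSq]
      rw [hneg, ← sub_eq_add_neg] at h
      exact h
    have h2 : S.eSq (2 * β) (S.coeff (P t)) ≤ ENNReal.ofReal L' * S.eSq (1 + 2 * β) (x t) := by
      refine (S.eSq_le_of_le (by linarith : 2 * β ≤ 1 + 2 * β) _).trans ?_
      rw [hL', ENNReal.ofReal_mul (Real.rpow_nonneg (S.pos 0).le _), mul_assoc]
      gcongr
      exact hPle t ht
    have h3 : S.eSq (2 * β) (g t) + ENNReal.ofReal L' * S.eSq (1 + 2 * β) (x t) =
        ∑' k, ENNReal.ofReal (S.α k ^ (2 * β) * (g t k ^ 2 + L' * (S.α k * x t k ^ 2))) := by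
      rw [eSq, eSq, ← ENNReal.tsum_mul_left, ← ENNReal.tsum_add]
      refine tsum_congr fun k => ?_
      rw [← ENNReal.ofReal_mul hL'0, ← ENNReal.ofReal_add (S.rpow_mul_sq_nonneg _ _ _)
        (mul_nonneg hL'0 (S.rpow_mul_sq_nonneg _ _ _)), add_comm 1, Real.rpow_add_one (S.pos k).ne']
      congr 1
      ring
    calc S.eSq 0 (E t)
        ≤ ENNReal.ofReal (c ^ 2) * (2 * S.eSq (2 * β) (g t) +
            2 * (ENNReal.ofReal L' * S.eSq (1 + 2 * β) (x t))) := by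
          refine (S.eSq_inv_mul_le hc (fun k => (hcb k).1) _).trans ?_
          gcongr
          exact h1.trans (by gcongr)
      _ = ENNReal.ofReal (2 * c ^ 2) *
            ∑' k, ENNReal.ofReal (S.α k ^ (2 * β) * (g t k ^ 2 + L' * (S.α k * x t k ^ 2))) := by
          rw [← h3, ← mul_add, ← mul_assoc, mul_comm 2 (c ^ 2), ENNReal.ofReal_mul (sq_nonneg c)]
          simp
      _ ≤ _ := by
          rw [ENNReal.ofReal_mul (by positivity : 0 ≤ 2 * c ^ 2), mul_assoc,
            ← ENNReal.tsum_mul_left (a := ENNReal.ofReal ((1 + μ ^ 2) * A))]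
          gcongr with k
          exact hterm t ht k
  -- Only finiteness at each time matters here, so the crude pointwise bound of the velocity by the
  -- energy, with its factor `1/μ`, is allowed.
  have hmem : ∀ t ∈ Icc 0 T, E t ∈ S.hsSubmodule 0 := by
    intro t ht
    rw [mem_hsSubmodule_iff_eSq_ne_top]
    have h1 : ∑' k, ENNReal.ofReal (S.α k ^ (2 * β)) * W k t ≤
        ENNReal.ofReal (1 + 2 / μ) * ∑' k, ENNReal.ofReal (S.α k ^ (2 * β) * e k) := by
      rw [← ENNReal.tsum_mul_left]
      refine ENNReal.tsum_le_tsum fun k => ?_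
      rw [ENNReal.ofReal_mul (hα2 k), mul_left_comm]
      gcongr
      rw [← ENNReal.ofReal_mul (by positivity)]
      by_cases hts : t ∈ Icc (T - 1) T
      · rw [hW]
        simp only
        rw [indicator_of_mem hts]
        refine ENNReal.ofReal_le_ofReal ?_
        have h := S.waveMode_energy_le_two_mul hμ (sub_nonneg.2 ht.2) k (w k)
        have h' : 0 ≤ S.α k * S.waveMode μ (T - t) k (w k) 0 ^ 2 :=
          mul_nonneg (S.pos k).le (sq_nonneg _)
        have h2 : S.waveMode μ (T - t) k (w k) 1 ^ 2 ≤ 2 * e k / μ := by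
          rw [le_div_iff₀ hμ]
          simp only [he]
          linarith
        calc _ ≤ e k + 2 * e k / μ := by gcongr
          _ = _ := by ring
      · simp [hW, indicator_of_notMem hts]
    exact ne_top_of_le_ne_top (ENNReal.mul_ne_top ENNReal.ofReal_ne_top (ne_top_of_le_ne_top
      (ENNReal.mul_ne_top ENNReal.ofReal_ne_top (ne_top_of_le_ne_top ENNReal.ofReal_ne_top hesum))
      h1)) (hpt t ht)
  classical
  -- The value `0` is never used on `[0, T]`, by `hmem`.
  set η : ℝ → L2 D := fun t => if h : E t ∈ S.hsSubmodule 0 then S.l2Equiv.symm ⟨E t, h⟩ else 0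
    with hη
  have hηc : ∀ t ∈ Icc 0 T, S.coeff (η t) = E t := by
    intro t ht
    rw [hη]
    simp only
    rw [dif_pos (hmem t ht)]
    exact S.coeff_l2Equiv_symm ⟨E t, hmem t ht⟩
  have hlam0 : ∀ k, lam k ≠ 0 := fun k => by
    have h1 := mul_pos (inv_pos.2 hc) (Real.rpow_pos_of_pos (S.pos k) (-β))
    exact (h1.trans_le (hcb k).1).ne'
  refine ⟨η, ?_, ?_, ?_⟩
  · refine S.aestronglyMeasurable_of_coeff fun k => ?_
    have h1 : ContinuousOn (fun t => E t k) (Ioo 0 T) := by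
      refine continuousOn_const.mul (ContinuousOn.sub ?_ ?_)
      · exact (S.continuous_steerForce F μ T (w k) k).continuousOn
      · exact (S.continuous_coeff k).comp_continuousOn (hP.mono Ioo_subset_Icc_self)
    refine (h1.aestronglyMeasurable measurableSet_Ioo).congr ?_
    filter_upwards [ae_restrict_mem measurableSet_Ioo] with t ht
    rw [hηc t (Ioo_subset_Icc_self ht)]
  · intro t ht k
    rw [coeff_add, Pi.add_apply, S.coeff_apply_of_diagonal hlam, hηc t ht]
    simp only [hE]
    rw [mul_inv_cancel_left₀ (hlam0 k)]
    ring
  · have hWm : ∀ k, AEMeasurable (W k) (volume.restrict (Ioo 0 T)) := by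
      intro k
      have h1 : Continuous fun t => e k + S.waveMode μ (T - t) k (w k) 1 ^ 2 :=
        continuous_const.add ((S.continuous_waveMode_sub μ T k (w k) 1).pow 2)
      exact (h1.measurable.ennreal_ofReal.indicator measurableSet_Icc).aemeasurable
    have hWint : ∀ k, ∫⁻ t in Ioo 0 T, W k t ≤ ENNReal.ofReal (2 * e k) := by
      intro k
      refine (setLIntegral_le_lintegral _ _).trans ?_
      rw [hW]
      simp only
      rw [lintegral_indicator measurableSet_Icc]
      exact S.lintegral_waveMode_snd_sq_le hμ T k (w k)
    have hint : ∫⁻ t in Ioo 0 T, ‖η t‖ₑ ^ 2 ≤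
        ENNReal.ofReal ((√(4 * c ^ 2 * A) * (1 + μ) ^ 2 * ‖r‖) ^ 2) := by
      calc ∫⁻ t in Ioo 0 T, ‖η t‖ₑ ^ 2
          ≤ ∫⁻ t in Ioo 0 T, ENNReal.ofReal (2 * c ^ 2 * ((1 + μ ^ 2) * A)) *
              ∑' k, ENNReal.ofReal (S.α k ^ (2 * β)) * W k t := by
            refine setLIntegral_mono' measurableSet_Ioo fun t ht => ?_
            rw [S.enorm_sq_eq_eSq_coeff, hηc t (Ioo_subset_Icc_self ht)]
            exact hpt t (Ioo_subset_Icc_self ht)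
        _ = ENNReal.ofReal (2 * c ^ 2 * ((1 + μ ^ 2) * A)) *
              ∑' k, ENNReal.ofReal (S.α k ^ (2 * β)) * ∫⁻ t in Ioo 0 T, W k t := by
            rw [lintegral_const_mul' _ _ ENNReal.ofReal_ne_top,
              lintegral_tsum fun k => (hWm k).const_mul _]
            congr 1
            exact tsum_congr fun k => lintegral_const_mul'' _ (hWm k)
        _ ≤ ENNReal.ofReal (2 * c ^ 2 * ((1 + μ ^ 2) * A)) *
              ∑' k, ENNReal.ofReal 2 * ENNReal.ofReal (S.α k ^ (2 * β) * e k) := by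
            refine mul_le_mul_right (ENNReal.tsum_le_tsum fun k => ?_) _
            rw [ENNReal.ofReal_mul (hα2 k), mul_left_comm, ← ENNReal.ofReal_mul zero_le_two]
            exact mul_le_mul_right (hWint k) _
        _ ≤ ENNReal.ofReal (2 * c ^ 2 * ((1 + μ ^ 2) * A)) *
              (ENNReal.ofReal 2 * ENNReal.ofReal ((1 + μ) * ‖r‖ ^ 2)) := by
            rw [ENNReal.tsum_mul_left]
            gcongr
        _ ≤ _ := by
            rw [← ENNReal.ofReal_mul zero_le_two, ← ENNReal.ofReal_mul (by positivity)]
            refine ENNReal.ofReal_le_ofReal ?_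
            rw [mul_pow, mul_pow, Real.sq_sqrt (by positivity)]
            -- Rounding up to `(1 + μ)⁴` makes the square root equal to `(1 + μ)²`.
            have h1 : (1 + μ ^ 2) * (1 + μ) ≤ ((1 + μ) ^ 2) ^ 2 := by
              nlinarith [pow_pos hμ 2, pow_pos hμ 3, pow_pos hμ 4]
            calc 2 * c ^ 2 * ((1 + μ ^ 2) * A) * (2 * ((1 + μ) * ‖r‖ ^ 2))
                = 4 * c ^ 2 * A * ((1 + μ ^ 2) * (1 + μ)) * ‖r‖ ^ 2 := by ring
              _ ≤ _ := by gcongr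
    rw [eLpNorm_eq_lintegral_rpow_enorm_toReal two_ne_zero ENNReal.ofNat_ne_top]
    simp only [ENNReal.toReal_ofNat, ENNReal.rpow_ofNat]
    refine (ENNReal.rpow_le_rpow hint (by norm_num)).trans (le_of_eq ?_)
    rw [ENNReal.ofReal_pow (by positivity), ← ENNReal.rpow_natCast, ← ENNReal.rpow_mul]
    norm_num

theorem phaseIncl_fst_coe {δ δ' : ℝ} (h : δ' ≤ δ) (r : S.Phase δ) :
    (S.phaseIncl h r).1.1 = r.1.1 :=
  S.hsIncl_coe h r.1

theorem phaseIncl_snd_coe {δ δ' : ℝ} (h : δ' ≤ δ) (r : S.Phase δ) :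
    (S.phaseIncl h r).2.1 = r.2.1 :=
  S.hsIncl_coe (sub_le_sub_right h 1) r.2

theorem steerPath_fst_mem (F : SmoothStep) {μ : ℝ} (hμ : 0 < μ) (T : ℝ) {δ : ℝ} (r : S.Phase δ)
    {q : S.Phase 0} (h1 : q.1.1 = r.1.1) (h2 : q.2.1 = r.2.1) (t : ℝ) :
    (S.steerPath F hμ T q t).1.1 ∈ S.hsSubmodule δ := by
  have h := (S.hsSubmodule δ).smul_mem (F.φ (t - (T - 1)))
    (S.waveSemigroup hμ δ (T - t) (r.1, -r.2)).1.2
  have heq : (S.steerPath F hμ T q t).1.1 =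
      F.φ (t - (T - 1)) • (S.waveSemigroup hμ δ (T - t) (r.1, -r.2)).1.1 := by
    funext k
    change F.φ (t - (T - 1)) * S.waveMode μ (T - t) k ![q.1.1 k, -q.2.1 k] 0 =
      F.φ (t - (T - 1)) * S.waveMode μ (T - t) k ![r.1.1 k, -r.2.1 k] 0
    rw [h1, h2]
  rw [heq]
  exact h

theorem intervalIntegrable_waveMode_force {μ : ℝ} (hμ : 0 < μ) {t : ℝ} (ht : 0 ≤ t)
    {h : ℝ → L2 D} (hh : IntervalIntegrable h volume 0 t) (k : ℕ) (i : Fin 2) :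
    IntervalIntegrable (fun s => S.waveMode μ (t - s) k ![0, μ⁻¹ * S.coeff (h s) k] i)
      volume 0 t := by
  have h1 := S.intervalIntegrable_waveSemigroup_force hμ ht hh
  rw [intervalIntegrable_iff] at h1 ⊢
  have h2 := (S.modeL 0 k i).integrable_comp h1
  simp only [modeL_apply, mode_waveSemigroup, mode_force] at h2
  exact h2

/-- The end point of a controlled path of duration at least `1` can be moved by `r ∈ 𝓗_{1+2β}`
at the price of a change of the control proportional to `‖r‖`. -/
theorem exists_perturbation {Q : L2 D →L[ℝ] L2 D} {B : L2 D → L2 D} {β : ℝ}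
    (hβ : 0 ≤ 1 + 2 * β) (hQ : S.IsDiagonalOfOrder Q β)
    (hB : ∀ δ ∈ Icc (0 : ℝ) (1 + 2 * β), S.IsSmallLipschitz B δ) (hB0 : B 0 = 0) :
    ∃ M : ℝ, 0 ≤ M ∧ ∀ {μ : ℝ} (hμ : 0 < μ) {T : ℝ} (_ : 1 ≤ T) {ψ : ℝ → L2 D}
      (_ : MemLp ψ 2 (volume.restrict (Ioo 0 T))) {z : ℝ → S.Phase 0} (_ : z 0 = 0)
      (_ : S.IsMildSolution Q B hμ 0 T ψ z) (r : S.Phase (1 + 2 * β)),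
      ∃ (ψ' : ℝ → L2 D) (z' : ℝ → S.Phase 0), MemLp ψ' 2 (volume.restrict (Ioo 0 T)) ∧
        z' 0 = 0 ∧ z' T = z T + S.phaseIncl hβ r ∧ S.IsMildSolution Q B hμ 0 T ψ' z' ∧
        eLpNorm ψ' 2 (volume.restrict (Ioo 0 T)) ≤
          eLpNorm ψ 2 (volume.restrict (Ioo 0 T)) + ENNReal.ofReal (M * (1 + μ) ^ 2 * ‖r‖) := by
  obtain ⟨F⟩ := SmoothStep.nonempty
  obtain ⟨L, hL, hLip⟩ := (hB (1 + 2 * β) ⟨hβ, le_rfl⟩).exists_eSq_le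
  obtain ⟨M, hM, hcontrol⟩ := S.exists_steering_control hQ F hL
  refine ⟨M, hM, ?_⟩
  intro μ hμ T hT ψ hψ z hz0 hz r
  have hBc : Continuous B := (hB 0 ⟨le_rfl, hβ⟩).continuous
  obtain ⟨hzc, hzm⟩ := (S.isMildSolution_iff hBc hμ hψ hz0).1 hz
  set q := S.phaseIncl hβ r with hq
  have hq1 : q.1.1 = r.1.1 := S.phaseIncl_fst_coe hβ r
  have hq2 : q.2.1 = r.2.1 := S.phaseIncl_snd_coe hβ r
  set w := S.steerPath F hμ T q with hw
  have hw0 : w 0 = 0 := S.steerPath_zero F hμ hT q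
  have hwc : ContinuousOn w (Icc 0 T) := S.continuousOn_steerPath F hμ T q
  have hzwc : ContinuousOn (fun t => z t + w t) (Icc 0 T) := hzc.add hwc
  have hdiff : ∀ t, S.coeff (S.l2Equiv.symm (z t + w t).1 - S.l2Equiv.symm (z t).1) =
      (w t).1.1 := fun t => by
    rw [← map_sub, coeff_l2Equiv_symm, Prod.fst_add, add_sub_cancel_left]
  have hcont : ∀ {y : ℝ → S.Phase 0}, ContinuousOn y (Icc 0 T) →
      ContinuousOn (fun t => B (S.l2Equiv.symm (y t).1)) (Icc 0 T) := fun hy =>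
    (hBc.comp (S.l2Equiv.symm.continuous.comp continuous_fst)).comp_continuousOn hy
  -- The path `z + w` is prescribed, so no fixed point is needed: the extra control has to supply
  -- the forcing of `w` minus the change in `B`.
  obtain ⟨η, hηm, hη, hηle⟩ := hcontrol hμ r q
    (fun t => B (S.l2Equiv.symm (z t + w t).1) - B (S.l2Equiv.symm (z t).1)) hq1 hq2
    ((hcont hzwc).sub (hcont hzc)) (fun t ht => by
      -- The Lipschitz bound holds only between points of `H^{1+2β}`; the regularity of controlled
      -- paths puts `z t` there.
      have hm1 : S.coeff (S.l2Equiv.symm (z t).1) ∈ S.hsSubmodule (1 + 2 * β) := by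
        rw [coeff_l2Equiv_symm]
        exact (IsMildSolution.mem_hsSubmodule S hβ hQ hB hB0 hμ hψ hz0 hz ht).1
      have hm2 : S.coeff (S.l2Equiv.symm (z t + w t).1) ∈ S.hsSubmodule (1 + 2 * β) := by
        have h := (S.hsSubmodule (1 + 2 * β)).add_mem
          (S.steerPath_fst_mem F hμ T r hq1 hq2 t) hm1
        rwa [← hw, ← hdiff, ← coeff_add, sub_add_cancel] at h
      have h := hLip _ _ hm2 hm1
      rwa [hdiff] at h)
  have hηL : MemLp η 2 (volume.restrict (Ioo 0 T)) :=
    ⟨hηm, hηle.trans_lt ENNReal.ofReal_lt_top⟩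
  refine ⟨fun t => ψ t + η t, fun t => z t + w t, hψ.add hηL, ?_, ?_, ?_, ?_⟩
  · simp only [hz0, hw0, add_zero]
  · simp only [hw, S.steerPath_end F hμ T q]
  · refine (S.isMildSolution_iff hBc hμ (hψ.add hηL) (by simp only [hz0, hw0, add_zero])).2
      ⟨hzwc, fun t ht k i => ?_⟩
    have hi1 := S.intervalIntegrable_waveMode_force hμ ht.1
      ((S.intervalIntegrable_comp_fst hBc ht hzc).add (by
        have h := intervalIntegrable_of_memLp ht hψ
        rw [intervalIntegrable_iff] at h ⊢
        exact Q.integrable_comp h : IntervalIntegrable (fun s => Q (ψ s)) volume 0 t)) k i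
    have hi2 : IntervalIntegrable (fun s => S.waveMode μ (t - s) k
        ![0, μ⁻¹ * S.steerForce F μ T ![q.1.1 k, -q.2.1 k] k s] i) volume 0 t := by
      have h1 : (fun s => S.waveMode μ (t - s) k
          ![0, μ⁻¹ * S.steerForce F μ T ![q.1.1 k, -q.2.1 k] k s] i) =
          fun s => μ⁻¹ * S.steerForce F μ T ![q.1.1 k, -q.2.1 k] k s *
            S.waveMode μ (t - s) k ![0, 1] i := by
        funext s
        rw [waveMode_cons]
        ring
      rw [h1]
      exact ((continuous_const.mul (S.continuous_steerForce F μ T _ k)).mul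
        (S.continuous_waveMode_sub μ t k _ i)).intervalIntegrable _ _
    rw [mode_add, hzm t ht, hw, S.mode_steerPath_duhamel F hμ hT q t k i,
      ← intervalIntegral.integral_add hi1 hi2]
    refine intervalIntegral.integral_congr fun s hs => ?_
    rw [uIcc_of_le ht.1] at hs
    have h := hη s ⟨hs.1, hs.2.trans ht.2⟩ k
    rw [← h, ← hw, Pi.add_apply, waveMode_cons, waveMode_cons _ _ _ _ _ (μ⁻¹ * S.coeff (_ - _ + _) k),
      waveMode_cons _ _ _ _ _ (μ⁻¹ * S.coeff (_ + Q (ψ s + η s)) k), map_add,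
      coeff_add, coeff_add, coeff_add, coeff_add, coeff_sub]
    simp only [Pi.add_apply, Pi.sub_apply]
    ring
  · exact (eLpNorm_add_le hψ.1 hηm one_le_two).trans (by gcongr)

/-- A controlled path started at rest can be preceded by a unit of time spent at rest. -/
theorem IsMildSolution.exists_delay {Q : L2 D →L[ℝ] L2 D} {B : L2 D → L2 D}
    (hB : Continuous B) (hB0 : B 0 = 0) {μ : ℝ} (hμ : 0 < μ) {T : ℝ} (hT : 0 < T)
    {ψ : ℝ → L2 D} (hψ : MemLp ψ 2 (volume.restrict (Ioo 0 T))) {z : ℝ → S.Phase 0}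
    (hz0 : z 0 = 0) (hz : S.IsMildSolution Q B hμ 0 T ψ z) :
    ∃ (ψ' : ℝ → L2 D) (z' : ℝ → S.Phase 0), MemLp ψ' 2 (volume.restrict (Ioo 0 (T + 1))) ∧
      z' 0 = 0 ∧ z' (T + 1) = z T ∧ S.IsMildSolution Q B hμ 0 (T + 1) ψ' z' ∧
      eLpNorm ψ' 2 (volume.restrict (Ioo 0 (T + 1))) =
        eLpNorm ψ 2 (volume.restrict (Ioo 0 T)) := by
  obtain ⟨hzc, hzm⟩ := (S.isMildSolution_iff hB hμ hψ hz0).1 hz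
  have hmp : MeasurePreserving (fun t : ℝ => t - 1) (volume.restrict (Ioo 1 (T + 1)))
      (volume.restrict (Ioo 0 T)) := by
    have h := (measurePreserving_sub_right volume (1 : ℝ)).restrict_preimage
      (measurableSet_Ioo (a := (0 : ℝ)) (b := T))
    rwa [preimage_sub_const_Ioo, zero_add] at h
  have hset : (volume.restrict (Ioo (0 : ℝ) (T + 1))).restrict (Ioi 1) =
      volume.restrict (Ioo 1 (T + 1)) := by
    rw [Measure.restrict_restrict measurableSet_Ioi]
    congr 1
    ext t
    simp only [mem_inter_iff, mem_Ioi, mem_Ioo]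
    constructor
    · rintro ⟨h1, -, h2⟩
      exact ⟨h1, h2⟩
    · rintro ⟨h1, h2⟩
      exact ⟨h1, by linarith, h2⟩
  -- Up to time `1` the control and the path vanish, which is consistent because `B 0 = 0` makes
  -- rest an equilibrium.
  set ψ' : ℝ → L2 D := indicator (Ioi 1) fun t => ψ (t - 1) with hψ'
  set z' : ℝ → S.Phase 0 := fun t => z (max (t - 1) 0) with hz'
  have hψ'L : MemLp ψ' 2 (volume.restrict (Ioo 0 (T + 1))) := by
    rw [hψ', memLp_indicator_iff_restrict measurableSet_Ioi, hset]
    exact hψ.comp_measurePreserving hmp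
  have hz'0 : z' 0 = 0 := by
    simp only [hz']
    rw [max_eq_right (by norm_num), hz0]
  refine ⟨ψ', z', hψ'L, hz'0, ?_, ?_, ?_⟩
  · simp only [hz', add_sub_cancel_right]
    rw [max_eq_left hT.le]
  · refine (S.isMildSolution_iff hB hμ hψ'L hz'0).2 ⟨?_, fun t ht k i => ?_⟩
    · refine hzc.comp (by fun_prop) fun t ht => ⟨le_max_right _ _, max_le ?_ hT.le⟩
      linarith [ht.2]
    · set f : ℝ → ℝ := fun s => S.waveMode μ (t - s) k
        ![0, μ⁻¹ * S.coeff (B (S.l2Equiv.symm (z' s).1) + Q (ψ' s)) k] i with hf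
      have hzero : ∀ s ≤ 1, f s = 0 := by
        intro s hs
        have h1 : z' s = 0 := by
          simp only [hz']
          rw [max_eq_right (by linarith), hz0]
        have h2 : ψ' s = 0 := indicator_of_notMem (by simpa using hs) _
        simp only [hf, h1, h2]
        rw [waveMode_cons, Prod.fst_zero, map_zero, map_zero, hB0, add_zero, coeff_zero]
        simp
      rcases le_total t 1 with h1 | h1
      · have h2 : z' t = 0 := by
          simp only [hz']
          rw [max_eq_right (by linarith), hz0]
        rw [h2, mode_zero, intervalIntegral.integral_of_le ht.1]
        refine (setIntegral_eq_zero_of_forall_eq_zero fun s hs => ?_).symm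
        exact hzero s (hs.2.trans h1)
      · have h2 : ∫ s in (0 : ℝ)..t, f s = ∫ s in (1 : ℝ)..t, f s := by
          rw [intervalIntegral.integral_of_le ht.1, intervalIntegral.integral_of_le h1]
          refine setIntegral_eq_of_subset_of_forall_sdiff_eq_zero measurableSet_Ioc
            (Ioc_subset_Ioc_left zero_le_one) fun s hs => hzero s ?_
          by_contra h
          exact hs.2 ⟨not_le.1 h, hs.1.2⟩
        have h3 : ∫ s in (1 : ℝ)..t, f s = ∫ s in (1 : ℝ)..t, (fun s => S.waveMode μ (t - 1 - s) k
            ![0, μ⁻¹ * S.coeff (B (S.l2Equiv.symm (z s).1) + Q (ψ s)) k] i) (s - 1) := by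
          rw [intervalIntegral.integral_of_le h1, intervalIntegral.integral_of_le h1]
          refine setIntegral_congr_fun measurableSet_Ioc fun s hs => ?_
          have h4 : ψ' s = ψ (s - 1) := indicator_of_mem (mem_Ioi.2 hs.1) _
          have h5 : z' s = z (s - 1) := by
            simp only [hz']
            rw [max_eq_left (by linarith [hs.1])]
          simp only [hf, h4, h5]
          rw [show t - 1 - (s - 1) = t - s by ring]
        have h6 : z' t = z (t - 1) := by
          simp only [hz']
          rw [max_eq_left (by linarith)]
        rw [h2, h3, h6, intervalIntegral.integral_comp_sub_right (fun s => S.waveMode μ (t - 1 - s) k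
            ![0, μ⁻¹ * S.coeff (B (S.l2Equiv.symm (z s).1) + Q (ψ s)) k] i), sub_self]
        exact hzm (t - 1) ⟨by linarith, by linarith [ht.2]⟩ k i
  · rw [hψ', eLpNorm_indicator_eq_eLpNorm_restrict measurableSet_Ioi, hset]
    exact eLpNorm_comp_measurePreserving hψ.1 hmp

/-! ### Lipschitz continuity of the square root of the quasi-potential -/

/-- The square root of `2 x`: the size of a control whose cost is `x`. -/
def controlSize (x : ℝ≥0∞) : ℝ≥0∞ := (2 * x) ^ (2 : ℝ)⁻¹

/-- Together with `le_controlSize_iff`, this moves inequalities between square roots onto the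
infimum over paths, with no need for near-minimisers. -/
theorem controlSize_le_iff {x a : ℝ≥0∞} : controlSize x ≤ a ↔ x ≤ a ^ 2 / 2 := by
  rw [controlSize, ENNReal.rpow_inv_le_iff two_pos, ENNReal.rpow_ofNat,
    ENNReal.le_div_iff_mul_le (Or.inl two_ne_zero) (Or.inl ENNReal.ofNat_ne_top), mul_comm]

theorem le_controlSize_iff {x a : ℝ≥0∞} : a ≤ controlSize x ↔ a ^ 2 / 2 ≤ x := by
  rw [controlSize, ENNReal.le_rpow_inv_iff two_pos, ENNReal.rpow_ofNat,
    ENNReal.div_le_iff two_ne_zero ENNReal.ofNat_ne_top, mul_comm]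

theorem controlSize_mono {x y : ℝ≥0∞} (h : x ≤ y) : controlSize x ≤ controlSize y :=
  controlSize_le_iff.2 (h.trans (controlSize_le_iff.1 le_rfl))

theorem controlSize_zero : controlSize 0 = 0 :=
  le_antisymm (controlSize_le_iff.2 zero_le) zero_le

theorem controlSize_ne_top_iff {x : ℝ≥0∞} : controlSize x ≠ ⊤ ↔ x ≠ ⊤ := by
  rw [controlSize]
  refine not_congr ?_
  rw [ENNReal.rpow_eq_top_iff_of_pos (by norm_num), ENNReal.mul_eq_top]
  simp

theorem toReal_eq_controlSize_sq (x : ℝ≥0∞) : x.toReal = (controlSize x).toReal ^ 2 / 2 := by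
  have h : x = controlSize x ^ 2 / 2 :=
    le_antisymm (controlSize_le_iff.1 le_rfl) (le_controlSize_iff.1 le_rfl)
  conv_lhs => rw [h]
  simp [ENNReal.toReal_div]

theorem lintegral_enorm_sq_eq (ν : Measure ℝ) (ψ : ℝ → L2 D) :
    ∫⁻ t, ‖ψ t‖ₑ ^ 2 ∂ν = eLpNorm ψ 2 ν ^ 2 := by
  rw [eLpNorm_eq_lintegral_rpow_enorm_toReal two_ne_zero ENNReal.ofNat_ne_top]
  simp only [ENNReal.toReal_ofNat, ENNReal.rpow_ofNat]
  rw [← ENNReal.rpow_natCast, ← ENNReal.rpow_mul]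
  norm_num

theorem quasipotential_le {Q : L2 D →L[ℝ] L2 D} {B : L2 D → L2 D} {μ : ℝ} (hμ : 0 < μ)
    {T : ℝ} (hT : 0 < T) {ψ : ℝ → L2 D} (hψ : MemLp ψ 2 (volume.restrict (Ioo 0 T)))
    {z : ℝ → S.Phase 0} (hz0 : z 0 = 0) (hz : S.IsMildSolution Q B hμ 0 T ψ z) :
    S.quasipotential Q B hμ (z T) ≤ eLpNorm ψ 2 (volume.restrict (Ioo 0 T)) ^ 2 / 2 := by
  rw [← lintegral_enorm_sq_eq]
  exact iInf_le_of_le T <| iInf_le_of_le hT <| iInf_le_of_le z <| iInf_le_of_le hz0 <|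
    iInf_le_of_le rfl <| iInf_le_of_le ψ <| iInf_le_of_le hψ <| iInf_le_of_le hz le_rfl

theorem le_quasipotential {Q : L2 D →L[ℝ] L2 D} {B : L2 D → L2 D} {μ : ℝ} (hμ : 0 < μ)
    {p : S.Phase 0} {c : ℝ≥0∞}
    (h : ∀ (T : ℝ) (_ : 0 < T) (ψ : ℝ → L2 D) (z : ℝ → S.Phase 0),
      MemLp ψ 2 (volume.restrict (Ioo 0 T)) → z 0 = 0 → z T = p →
      S.IsMildSolution Q B hμ 0 T ψ z →
      c ≤ eLpNorm ψ 2 (volume.restrict (Ioo 0 T)) ^ 2 / 2) :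
    c ≤ S.quasipotential Q B hμ p := by
  refine le_iInf fun T => le_iInf fun hT => le_iInf fun z => le_iInf fun hz0 =>
    le_iInf fun hzT => le_iInf fun ψ => le_iInf fun hψ => le_iInf fun hz => ?_
  rw [lintegral_enorm_sq_eq]
  exact h T hT ψ z hψ hz0 hzT hz

/-- The element of `H^δ` with given Fourier coefficients. -/
def Hs.mk {δ : ℝ} (x : ℕ → ℝ) (hx : x ∈ S.hsSubmodule δ) : S.Hs δ := ⟨x, hx⟩

theorem Hs.coe_mk {δ : ℝ} (x : ℕ → ℝ) (hx : x ∈ S.hsSubmodule δ) : (Hs.mk S x hx).1 = x := rfl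

theorem mem_range_phaseIncl_iff {δ δ' : ℝ} (h : δ' ≤ δ) (p : S.Phase δ') :
    p ∈ range (S.phaseIncl h) ↔
      p.1.1 ∈ S.hsSubmodule δ ∧ p.2.1 ∈ S.hsSubmodule (δ - 1) := by
  constructor
  · rintro ⟨r, rfl⟩
    rw [phaseIncl_fst_coe, phaseIncl_snd_coe]
    exact ⟨r.1.2, r.2.2⟩
  · rintro ⟨h1, h2⟩
    refine ⟨(Hs.mk S p.1.1 h1, Hs.mk S p.2.1 h2), Prod.ext (Subtype.ext ?_) (Subtype.ext ?_)⟩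
    · exact (S.phaseIncl_fst_coe h _).trans (Hs.coe_mk S p.1.1 h1)
    · exact (S.phaseIncl_snd_coe h _).trans (Hs.coe_mk S p.2.1 h2)

theorem hsIncl_zero {δ δ' : ℝ} (h : δ' ≤ δ) : S.hsIncl h 0 = 0 := by
  have h := S.hsIncl_sub h 0 0
  rwa [sub_self, sub_self] at h

theorem phaseIncl_sub {δ δ' : ℝ} (h : δ' ≤ δ) (p q : S.Phase δ) :
    S.phaseIncl h (p - q) = S.phaseIncl h p - S.phaseIncl h q :=
  Prod.ext (S.hsIncl_sub h p.1 q.1) (S.hsIncl_sub (sub_le_sub_right h 1) p.2 q.2)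

variable {S} {Q : L2 D →L[ℝ] L2 D} {B : L2 D → L2 D} {β : ℝ}

/-- Controlled paths stay in `𝓗_{1+2β}`, so for any other end point the infimum is over the empty
set. -/
theorem mem_range_of_quasipotential_lt_top (hβ : 0 ≤ 1 + 2 * β) (hQ : S.IsDiagonalOfOrder Q β)
    (hB : ∀ δ ∈ Icc (0 : ℝ) (1 + 2 * β), S.IsSmallLipschitz B δ) (hB0 : B 0 = 0)
    {μ : ℝ} (hμ : 0 < μ) {p : S.Phase 0} (hp : S.quasipotential Q B hμ p < ⊤) :
    p ∈ range (S.phaseIncl hβ) := by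
  by_contra hcon
  refine hp.not_ge (S.le_quasipotential hμ fun T hT ψ z hψ hz0 hzT hz => ?_)
  refine absurd ?_ hcon
  rw [mem_range_phaseIncl_iff, ← hzT]
  exact IsMildSolution.mem_hsSubmodule S hβ hQ hB hB0 hμ hψ hz0 hz ⟨hT.le, le_rfl⟩

theorem quasipotential_zero (hB : Continuous B) (hB0 : B 0 = 0) {μ : ℝ} (hμ : 0 < μ) :
    S.quasipotential Q B hμ 0 = 0 := by
  have hψ : MemLp (fun _ : ℝ => (0 : L2 D)) 2 (volume.restrict (Ioo (0 : ℝ) 1)) := MemLp.zero'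
  have hz : S.IsMildSolution Q B hμ 0 1 (fun _ => 0) fun _ => 0 := by
    refine (S.isMildSolution_iff hB hμ hψ rfl).2 ⟨continuousOn_const, fun t _ k i => ?_⟩
    have h : ∀ s, S.waveMode μ (t - s) k ![0, μ⁻¹ * S.coeff (B (S.l2Equiv.symm
        (0 : S.Phase 0).1) + Q (0 : L2 D)) k] i = 0 := fun s => by
      rw [waveMode_cons, Prod.fst_zero, map_zero, map_zero, hB0, add_zero, coeff_zero]
      simp
    simp only [h, mode_zero, intervalIntegral.integral_zero]
  refine le_antisymm ((S.quasipotential_le hμ one_pos hψ rfl hz).trans ?_) zero_le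
  have h0 : eLpNorm (fun _ : ℝ => (0 : L2 D)) 2 (volume.restrict (Ioo (0 : ℝ) 1)) = 0 :=
    eLpNorm_zero'
  simp [h0]

/-- The square root of the quasi-potential is Lipschitz continuous on `𝓗_{1+2β}`. -/
theorem exists_controlSize_quasipotential_le (hβ : 0 ≤ 1 + 2 * β)
    (hQ : S.IsDiagonalOfOrder Q β)
    (hB : ∀ δ ∈ Icc (0 : ℝ) (1 + 2 * β), S.IsSmallLipschitz B δ) (hB0 : B 0 = 0) :
    ∃ M : ℝ, 0 ≤ M ∧ ∀ {μ : ℝ} (hμ : 0 < μ) (p : S.Phase 0) (r : S.Phase (1 + 2 * β)),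
      controlSize (S.quasipotential Q B hμ (p + S.phaseIncl hβ r)) ≤
        controlSize (S.quasipotential Q B hμ p) + ENNReal.ofReal (M * (1 + μ) ^ 2 * ‖r‖) := by
  obtain ⟨M, hM, hpert⟩ := S.exists_perturbation hβ hQ hB hB0
  refine ⟨M, hM, fun {μ} hμ p r => ?_⟩
  have hBc : Continuous B := (hB 0 ⟨le_rfl, hβ⟩).continuous
  -- In this form the claim is a lower bound for an infimum and can be checked on each competing
  -- path.
  rw [← tsub_le_iff_right, le_controlSize_iff]
  refine S.le_quasipotential hμ fun T hT ψ z hψ hz0 hzT hz => ?_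
  -- The competing path may last less than the unit of time required for steering.
  obtain ⟨ψ₁, z₁, hψ₁, hz₁0, hz₁T, hz₁, hn₁⟩ :=
    IsMildSolution.exists_delay S hBc hB0 hμ hT hψ hz0 hz
  obtain ⟨ψ₂, z₂, hψ₂, hz₂0, hz₂T, hz₂, hn₂⟩ :=
    hpert hμ (by linarith : (1 : ℝ) ≤ T + 1) hψ₁ hz₁0 hz₁ r
  have h := S.quasipotential_le hμ (by linarith : (0 : ℝ) < T + 1) hψ₂ hz₂0 hz₂
  rw [hz₂T, hz₁T, hzT, ← controlSize_le_iff] at h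
  rw [hn₁] at hn₂
  gcongr
  exact tsub_le_iff_right.2 (h.trans hn₂)

/-- For each final velocity `y` the end point is moved by `(r, 0)`, which leaves `y` unchanged; the
infimum over `y` is then taken. -/
theorem exists_controlSize_positionQuasipotential_le (hβ : 0 ≤ 1 + 2 * β)
    (hQ : S.IsDiagonalOfOrder Q β)
    (hB : ∀ δ ∈ Icc (0 : ℝ) (1 + 2 * β), S.IsSmallLipschitz B δ) (hB0 : B 0 = 0) :
    ∃ M : ℝ, 0 ≤ M ∧ ∀ {μ : ℝ} (hμ : 0 < μ) (x : S.Hs 0) (r : S.Hs (1 + 2 * β)),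
      controlSize (S.positionQuasipotential Q B hμ (x + S.hsIncl hβ r)) ≤
        controlSize (S.positionQuasipotential Q B hμ x) +
          ENNReal.ofReal (M * (1 + μ) ^ 2 * ‖r‖) := by
  obtain ⟨M, hM, hLip⟩ := exists_controlSize_quasipotential_le hβ hQ hB hB0
  refine ⟨M, hM, fun {μ} hμ x r => ?_⟩
  rw [← tsub_le_iff_right, le_controlSize_iff]
  refine le_iInf fun y => ?_
  rw [← le_controlSize_iff, tsub_le_iff_right]
  have h := hLip hμ (x, y) (r, 0)
  have h0 : S.phaseIncl hβ (r, 0) = (S.hsIncl hβ r, 0) := by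
    rw [phaseIncl, hsIncl_zero]
  have hn : ‖((r, 0) : S.Phase (1 + 2 * β))‖ = ‖r‖ := by simp [Prod.norm_def]
  rw [h0, hn, Prod.mk_add_mk, add_zero] at h
  exact (controlSize_mono (iInf_le _ y)).trans h

/-! ### From a Lipschitz square root to continuity uniform in `μ` -/

/-- Local Lipschitz bounds for a function whose square root is Lipschitz and vanishes at the
origin. -/
theorem abs_toReal_sub_le_of_controlSize {X : Type*} [NormedAddCommGroup X] {V : X → ℝ≥0∞}
    {K : ℝ} (hK : 0 ≤ K) (h0 : V 0 = 0)
    (hV : ∀ w w', controlSize (V w') ≤ controlSize (V w) + ENNReal.ofReal (K * ‖w' - w‖))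
    (w : X) : V w ≠ ⊤ ∧ ∀ w', |(V w).toReal - (V w').toReal| ≤
      K ^ 2 * (‖w - w'‖ * (‖w‖ + ‖w'‖)) := by
  have hbd : ∀ w, controlSize (V w) ≤ ENNReal.ofReal (K * ‖w‖) := fun w => by
    have h := hV 0 w
    rwa [h0, controlSize_zero, zero_add, sub_zero] at h
  have hfin : ∀ w, controlSize (V w) ≠ ⊤ := fun w =>
    ne_top_of_le_ne_top ENNReal.ofReal_ne_top (hbd w)
  refine ⟨controlSize_ne_top_iff.1 (hfin w), fun w' => ?_⟩
  have hle : ∀ w, (controlSize (V w)).toReal ≤ K * ‖w‖ := fun w =>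
    ENNReal.toReal_le_of_le_ofReal (by positivity) (hbd w)
  have hlip : ∀ w w', (controlSize (V w')).toReal - (controlSize (V w)).toReal ≤
      K * ‖w' - w‖ := fun w w' => by
    have h := ENNReal.toReal_mono (ENNReal.add_ne_top.2 ⟨hfin w, ENNReal.ofReal_ne_top⟩) (hV w w')
    rw [ENNReal.toReal_add (hfin w) ENNReal.ofReal_ne_top,
      ENNReal.toReal_ofReal (by positivity)] at h
    linarith
  rw [toReal_eq_controlSize_sq (V w), toReal_eq_controlSize_sq (V w')]
  set a := (controlSize (V w)).toReal with ha
  set b := (controlSize (V w')).toReal with hb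
  have ha0 : 0 ≤ a := ENNReal.toReal_nonneg
  have hb0 : 0 ≤ b := ENNReal.toReal_nonneg
  have hab : |a - b| ≤ K * ‖w - w'‖ := by
    refine abs_le.2 ⟨?_, hlip w' w⟩
    have := hlip w w'
    rw [norm_sub_rev] at this
    linarith
  have hsum : a + b ≤ K * (‖w‖ + ‖w'‖) := by
    linarith [hle w, hle w']
  -- A difference of squares: one factor is Lipschitz and the other grows linearly.
  calc |a ^ 2 / 2 - b ^ 2 / 2| = |a - b| * (a + b) / 2 := by
        rw [show a ^ 2 / 2 - b ^ 2 / 2 = (a - b) * ((a + b) / 2) by ring, abs_mul,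
          abs_of_nonneg (by positivity : 0 ≤ (a + b) / 2)]
        ring
    _ ≤ |a - b| * (a + b) := half_le_self (by positivity)
    _ ≤ K * ‖w - w'‖ * (K * (‖w‖ + ‖w'‖)) := by gcongr
    _ = _ := by ring

theorem tendsto_norm_sub_mul {X : Type*} [NormedAddCommGroup X] (K : ℝ) (w : X) :
    Tendsto (fun w' => K ^ 2 * (‖w - w'‖ * (‖w‖ + ‖w'‖))) (𝓝 w) (𝓝 0) := by
  have h : Continuous fun w' : X => K ^ 2 * (‖w - w'‖ * (‖w‖ + ‖w'‖)) := by fun_prop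
  simpa using h.tendsto w

theorem continuous_toReal_of_controlSize {X : Type*} [NormedAddCommGroup X] {V : X → ℝ≥0∞}
    {K : ℝ} (hK : 0 ≤ K) (h0 : V 0 = 0)
    (hV : ∀ w w', controlSize (V w') ≤ controlSize (V w) + ENNReal.ofReal (K * ‖w' - w‖)) :
    Continuous fun w => (V w).toReal := by
  refine continuous_iff_continuousAt.2 fun w => tendsto_iff_dist_tendsto_zero.2 ?_
  refine squeeze_zero (fun _ => dist_nonneg) (fun w' => ?_) (tendsto_norm_sub_mul K w)
  rw [dist_comm, Real.dist_eq]
  exact (abs_toReal_sub_le_of_controlSize hK h0 hV w).2 w'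

theorem tendsto_iSup_of_controlSize {X : Type*} [NormedAddCommGroup X]
    {V : ∀ μ : ℝ, 0 < μ → X → ℝ≥0∞} {M : ℝ} (hM : 0 ≤ M) (h0 : ∀ μ hμ, V μ hμ 0 = 0)
    (hV : ∀ μ hμ w w', controlSize (V μ hμ w') ≤
      controlSize (V μ hμ w) + ENNReal.ofReal (M * (1 + μ) ^ 2 * ‖w' - w‖))
    {w : X} {u : ℕ → X} (hu : Tendsto u atTop (𝓝 w)) :
    Tendsto (fun n => ⨆ (μ : ℝ) (hμ : 0 < μ) (_ : μ < 1),
      ENNReal.ofReal |(V μ hμ w).toReal - (V μ hμ (u n)).toReal|) atTop (𝓝 0) := by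
  have hlim : Tendsto (fun n => ENNReal.ofReal
      ((M * 4) ^ 2 * (‖w - u n‖ * (‖w‖ + ‖u n‖)))) atTop (𝓝 0) := by
    have h := ENNReal.tendsto_ofReal ((tendsto_norm_sub_mul (M * 4) w).comp hu)
    rwa [ENNReal.ofReal_zero] at h
  refine tendsto_of_tendsto_of_tendsto_of_le_of_le tendsto_const_nhds hlim
    (fun n => zero_le) fun n => iSup_le fun μ => iSup_le fun hμ => iSup_le fun hμ1 => ?_
  refine ENNReal.ofReal_le_ofReal
    ((abs_toReal_sub_le_of_controlSize (by positivity) (h0 μ hμ) (hV μ hμ) w).2 (u n) |>.trans ?_)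
  -- The restriction `μ < 1` enters here, replacing the constant by `4 M` for all `μ` at once.
  have h4 : (1 + μ) ^ 2 ≤ 4 := by nlinarith
  gcongr

end DirichletSpectrum

end

theorem mainTheorem4 {d : ℕ} (hd : 1 ≤ d) {D : Set (EuclideanSpace ℝ (Fin d))}
    (hDopen : IsOpen D) (hDbdd : Bornology.IsBounded D)
    (S : DirichletSpectrum D)
    (hWeyl : S.α =Θ[atTop] fun k : ℕ => (k : ℝ) ^ (2 / (d : ℝ)))
    (β : ℝ) (hβ : ((d : ℝ) - 2) / 4 < β)
    (Q : L2 D →L[ℝ] L2 D) (hQ : S.IsDiagonalOfOrder Q β)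
    (B : L2 D → L2 D) (hB : ∀ δ ∈ Icc (0 : ℝ) (1 + 2 * β), S.IsSmallLipschitz B δ)
    (hB0 : B 0 = 0) :
    (∀ (μ : ℝ) (hμ : 0 < μ),
      (∀ p : S.Phase 0, S.quasipotential Q B hμ p < ⊤ ↔
        p ∈ Set.range (S.phaseIncl (one_add_two_mul_nonneg_of_lt hd hβ))) ∧
      (∀ x : S.Hs 0, S.positionQuasipotential Q B hμ x < ⊤ ↔
        x ∈ Set.range (S.hsIncl (one_add_two_mul_nonneg_of_lt hd hβ))) ∧
      Continuous (fun w : S.Phase (1 + 2 * β) =>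
        (S.quasipotential Q B hμ
          (S.phaseIncl (one_add_two_mul_nonneg_of_lt hd hβ) w)).toReal) ∧
      Continuous (fun x : S.Hs (1 + 2 * β) =>
        (S.positionQuasipotential Q B hμ
          (S.hsIncl (one_add_two_mul_nonneg_of_lt hd hβ) x)).toReal)) ∧
    (∀ (w : S.Phase (1 + 2 * β)) (wn : ℕ → S.Phase (1 + 2 * β)), Tendsto wn atTop (𝓝 w) →
      Tendsto (fun n => ⨆ (μ : ℝ) (hμ : 0 < μ) (_ : μ < 1), ENNReal.ofReal
        |(S.quasipotential Q B hμ
            (S.phaseIncl (one_add_two_mul_nonneg_of_lt hd hβ) w)).toReal -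
          (S.quasipotential Q B hμ
            (S.phaseIncl (one_add_two_mul_nonneg_of_lt hd hβ) (wn n))).toReal|)
        atTop (𝓝 0)) ∧
    (∀ (x : S.Hs (1 + 2 * β)) (xn : ℕ → S.Hs (1 + 2 * β)), Tendsto xn atTop (𝓝 x) →
      Tendsto (fun n => ⨆ (μ : ℝ) (hμ : 0 < μ) (_ : μ < 1), ENNReal.ofReal
        |(S.positionQuasipotential Q B hμ
            (S.hsIncl (one_add_two_mul_nonneg_of_lt hd hβ) x)).toReal -
          (S.positionQuasipotential Q B hμ
            (S.hsIncl (one_add_two_mul_nonneg_of_lt hd hβ) (xn n))).toReal|)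
        atTop (𝓝 0)) := by
  have hβ' := one_add_two_mul_nonneg_of_lt hd hβ
  have hBc : Continuous B := (hB 0 ⟨le_rfl, hβ'⟩).continuous
  obtain ⟨M, hM, hLip⟩ :=
    DirichletSpectrum.exists_controlSize_quasipotential_le hβ' hQ hB hB0
  obtain ⟨N, hN, hLipN⟩ :=
    DirichletSpectrum.exists_controlSize_positionQuasipotential_le hβ' hQ hB hB0
  have hV : ∀ (μ : ℝ) (hμ : 0 < μ) (w w' : S.Phase (1 + 2 * β)),
      DirichletSpectrum.controlSize (S.quasipotential Q B hμ (S.phaseIncl hβ' w')) ≤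
        DirichletSpectrum.controlSize (S.quasipotential Q B hμ (S.phaseIncl hβ' w)) +
          ENNReal.ofReal (M * (1 + μ) ^ 2 * ‖w' - w‖) := by
    intro μ hμ w w'
    have h := hLip hμ (S.phaseIncl hβ' w) (w' - w)
    rwa [S.phaseIncl_sub, add_sub_cancel] at h
  have hU : ∀ (μ : ℝ) (hμ : 0 < μ) (x x' : S.Hs (1 + 2 * β)),
      DirichletSpectrum.controlSize (S.positionQuasipotential Q B hμ (S.hsIncl hβ' x')) ≤
        DirichletSpectrum.controlSize (S.positionQuasipotential Q B hμ (S.hsIncl hβ' x)) +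
          ENNReal.ofReal (N * (1 + μ) ^ 2 * ‖x' - x‖) := by
    intro μ hμ x x'
    have h := hLipN hμ (S.hsIncl hβ' x) (x' - x)
    rwa [S.hsIncl_sub, add_sub_cancel] at h
  have hV0 : ∀ (μ : ℝ) (hμ : 0 < μ), S.quasipotential Q B hμ (S.phaseIncl hβ' 0) = 0 := by
    intro μ hμ
    have h := S.phaseIncl_sub hβ' 0 0
    rw [sub_self, sub_self] at h
    rw [h, DirichletSpectrum.quasipotential_zero hBc hB0]
  have hU0 : ∀ (μ : ℝ) (hμ : 0 < μ), S.positionQuasipotential Q B hμ (S.hsIncl hβ' 0) = 0 := by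
    intro μ hμ
    refine le_antisymm (iInf_le_of_le 0 (le_of_eq ?_)) zero_le
    rw [S.hsIncl_zero]
    exact DirichletSpectrum.quasipotential_zero hBc hB0 hμ
  refine ⟨fun μ hμ => ⟨fun p => ⟨fun hp => ?_, ?_⟩, fun x => ⟨fun hx => ?_, ?_⟩, ?_, ?_⟩, ?_, ?_⟩
  · exact DirichletSpectrum.mem_range_of_quasipotential_lt_top hβ' hQ hB hB0 hμ hp
  · rintro ⟨w, rfl⟩
    exact (DirichletSpectrum.abs_toReal_sub_le_of_controlSize
      (V := fun w => S.quasipotential Q B hμ (S.phaseIncl hβ' w)) (by positivity) (hV0 μ hμ)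
      (hV μ hμ) w).1.lt_top
  -- A finite infimum over velocities provides one end point `(x, y)` of finite cost, whose position
  -- component is `x`.
  · obtain ⟨y, hy⟩ := iInf_lt_iff.1 hx
    obtain ⟨w, hw⟩ := DirichletSpectrum.mem_range_of_quasipotential_lt_top hβ' hQ hB hB0 hμ hy
    exact ⟨w.1, congrArg Prod.fst hw⟩
  · rintro ⟨x, rfl⟩
    exact (DirichletSpectrum.abs_toReal_sub_le_of_controlSize
      (V := fun x => S.positionQuasipotential Q B hμ (S.hsIncl hβ' x)) (by positivity) (hU0 μ hμ)
      (hU μ hμ) x).1.lt_top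
  · exact DirichletSpectrum.continuous_toReal_of_controlSize
      (V := fun w => S.quasipotential Q B hμ (S.phaseIncl hβ' w)) (by positivity) (hV0 μ hμ) (hV μ hμ)
  · exact DirichletSpectrum.continuous_toReal_of_controlSize
      (V := fun x => S.positionQuasipotential Q B hμ (S.hsIncl hβ' x)) (by positivity) (hU0 μ hμ) (hU μ hμ)
  · intro w wn hwn
    exact DirichletSpectrum.tendsto_iSup_of_controlSize
      (V := fun _ hμ w => S.quasipotential Q B hμ (S.phaseIncl hβ' w)) hM hV0 hV hwn
  · intro x xn hxn
    exact DirichletSpectrum.tendsto_iSup_of_controlSize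
      (V := fun _ hμ x => S.positionQuasipotential Q B hμ (S.hsIncl hβ' x)) hN hU0 hU hxn
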